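/- Let $G$ be an infinite group with a finite symmetric generating set $F\ni e$, put $F^0=\{e\}$, and assume that $G$ has polynomial growth: $|F^n|\le g(n)$ for all $n\ge 0$, for some polynomial $g$; let $d$ be the least degree of such a polynomial. Let $\tau(x)=\min\{n\ge 0: x\in F^n\}$ be the length function of $F$. For $0<\alpha<1$ and $C>0$ let $\sigma_{\alpha,C}(x)=e^{C\tau(x)^\alpha}$, let $\ell^1(G,\sigma_{\alpha,C})$ be the convolution algebra of all $u:G\to\mathbb{C}$ with $\|u\|=\sum_{x\in G}|u(x)|\sigma_{\alpha,C}(x)<\infty$, and let $Z\ell^1(G,\sigma_{\alpha,C})$ be its centre with the same norm. Then $Z\ell^1(G,\sigma_{\alpha,C})$ is isomorphic, as a Banach algebra, to a $Q$-algebra, i.e. to a quotient of a uniform algebra by a closed ideal. Moreover, let $f$ be a real polynomial of degree $d$ and $0<\lambda\le 1$ with $\lambda f(n)\le|F^n|\le f(n)$ for all integers $n\ge0$. Let $\beta$ be a real number with $$\beta\ge\max\left\{1,\ \frac{6}{C\alpha(1-\alpha)},\ \frac{d+(1-\delta_1(\lambda))}{2}\right\}$$ (for instance $\beta$ equal to this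 maximum), where $\delta_1(\lambda)=1$ if $\lambda=1$ and $\delta_1(\lambda)=0$ otherwise. Put $p(x)=Cx^\alpha-\beta\ln(1+x)$, $K=\left(\frac{\beta^2}{C\alpha(1-\alpha)}\right)^{1/\alpha}$, $M=\max\{e^{p(t)-p(s)-p(r)}: t,s,r\in[0,4K]\cap\mathbb{Z}\}$, let $K_G$ be the (complex) Grothendieck constant, and $$\delta=e^{-1}\left(1+K_G\,M\,2^{\beta-1}\left[1+\sum_{n=1}^\infty\frac{f(n)-\lambda f(n-1)}{(1+n)^{2\beta}}\right]^{1/2}\right)^{-1},$$ where the series has nonnegative terms and $\delta=0$ if it diverges. Then $Z\ell^1(G,\sigma_{\alpha,C})$ satisfies the multi-variable $(\delta,1)$-von Neumann inequality: for every $n\in\mathbb{N}$, all $a_1,\dots,a_n\in Z\ell^1(G,\sigma_{\alpha,C})$ with $\|a_i\|\le\delta$, and every complex polynomial $P$ in $n$ variables without constant term, $$\|P(a_1,\dots,a_n)\|\le\sup\{|P(z_1,\dots,z_n)|: z_i\in\mathbb{C},\ |z_i|\le1\}.$$ -/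

import Mathlib

open scoped ENNReal Pointwise Polynomial

universe u

noncomputable section

/-! ### Weights and weighted group algebras -/

/-- A weight on a (discrete) group: a positive submultiplicative function. -/
structure Weight (G : Type u) [Group G] where
  toFun : G → ℝ
  pos' : ∀ x, 0 < toFun x
  submul' : ∀ x y, toFun (x * y) ≤ toFun x * toFun y

namespace Weight

variable {G : Type u} [Group G]

instance : CoeFun (Weight G) (fun _ => G → ℝ) := ⟨Weight.toFun⟩

theorem pos (w : Weight G) (x : G) : 0 < w x := w.pos' x

theorem submul (w : Weight G) (x y : G) : w (x * y) ≤ w x * w y := w.submul' x y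

end Weight

/-- The functions `f : G → ℂ` with `∑ |f x| w x < ∞`, as a space of functions. -/
def weightedL1Submodule {G : Type u} [Group G] (w : Weight G) : Submodule ℂ (G → ℂ) where
  carrier := {f | Summable fun x => ‖f x‖ * w x}
  zero_mem' := by simp [summable_zero]
  add_mem' := by
    intro f g hf hg
    refine Summable.of_nonneg_of_le (fun x => mul_nonneg (norm_nonneg _) (w.pos x).le)
      (fun x => ?_) (Summable.add hf hg)
    have := mul_le_mul_of_nonneg_right (norm_add_le (f x) (g x)) (w.pos x).le
    simpa [add_mul] using this
  smul_mem' := by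
    intro c f hf
    have : Summable fun x => ‖c‖ * (‖f x‖ * w x) := Summable.mul_left _ hf
    simpa [mul_assoc] using this

/-- The weighted group algebra `ℓ¹(G, w)`. -/
def WeightedL1 {G : Type u} [Group G] (w : Weight G) : Type u := weightedL1Submodule w

namespace WeightedL1

variable {G : Type u} [Group G] {w : Weight G}

instance : AddCommGroup (WeightedL1 w) := inferInstanceAs (AddCommGroup (weightedL1Submodule w))

instance : Module ℂ (WeightedL1 w) := inferInstanceAs (Module ℂ (weightedL1Submodule w))

instance : CoeFun (WeightedL1 w) (fun _ => G → ℂ) := ⟨fun f => f.1⟩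

@[ext] theorem ext {f g : WeightedL1 w} (h : ∀ x, f x = g x) : f = g := Subtype.ext (funext h)

theorem summable (f : WeightedL1 w) : Summable fun x => ‖f x‖ * w x := f.2

@[simp] theorem add_apply (f g : WeightedL1 w) (x : G) : (f + g) x = f x + g x := rfl

@[simp] theorem zero_apply (x : G) : (0 : WeightedL1 w) x = 0 := rfl

@[simp] theorem neg_apply (f : WeightedL1 w) (x : G) : (-f) x = -f x := rfl

@[simp] theorem smul_apply (c : ℂ) (f : WeightedL1 w) (x : G) : (c • f) x = c * f x := rfl

/-- The norm `∑ |f x| w x`. -/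
instance : Norm (WeightedL1 w) := ⟨fun f => ∑' x, ‖f x‖ * w x⟩

theorem norm_def (f : WeightedL1 w) : ‖f‖ = ∑' x, ‖f x‖ * w x := rfl

theorem term_nonneg (f : WeightedL1 w) (x : G) : 0 ≤ ‖f x‖ * w x :=
  mul_nonneg (norm_nonneg _) (w.pos x).le

theorem term_le_norm (f : WeightedL1 w) (x : G) : ‖f x‖ * w x ≤ ‖f‖ :=
  f.summable.le_tsum x fun y _ => f.term_nonneg y

theorem normedSpaceCore : NormedSpace.Core ℂ (WeightedL1 w) where
  norm_nonneg f := tsum_nonneg f.term_nonneg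
  norm_smul c f := by
    simp only [norm_def, smul_apply, norm_mul, mul_assoc]
    exact tsum_mul_left
  norm_triangle f g := by
    simp only [norm_def]
    rw [← f.summable.tsum_add g.summable]
    refine (f + g).summable.tsum_le_tsum (fun x => ?_) (f.summable.add g.summable)
    rw [← add_mul]
    exact mul_le_mul_of_nonneg_right (norm_add_le _ _) (w.pos x).le
  norm_eq_zero_iff f := by
    constructor
    · intro h
      ext x
      have h1 := f.term_le_norm x
      rw [h] at h1
      have h2 : ‖f x‖ ≤ 0 := by
        by_contra hc
        exact absurd h1 (not_le.2 (mul_pos (not_le.1 hc) (w.pos x)))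
      simpa using h2
    · rintro rfl
      simp [norm_def]

instance : NormedAddCommGroup (WeightedL1 w) := NormedAddCommGroup.ofCore normedSpaceCore

theorem summable_shear {a b : G → ℝ} (ha : Summable a) (hb : Summable b)
    (ha0 : ∀ x, 0 ≤ a x) (hb0 : ∀ x, 0 ≤ b x) :
    Summable fun p : G × G => a p.1 * b (p.1⁻¹ * p.2) := by
  have h := Summable.mul_of_nonneg ha hb ha0 hb0
  exact (Equiv.prodShear (Equiv.refl G) (fun y => Equiv.mulLeft y⁻¹)).summable_iff.2 h

theorem weight_le (w : Weight G) (x y : G) : w x ≤ w y * w (y⁻¹ * x) := by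
  have := w.submul y (y⁻¹ * x)
  rwa [mul_inv_cancel_left] at this

theorem conv_term_le (f g : WeightedL1 w) (x y : G) :
    ‖f y * g (y⁻¹ * x)‖ * w x ≤ (‖f y‖ * w y) * (‖g (y⁻¹ * x)‖ * w (y⁻¹ * x)) := by
  rw [norm_mul]
  calc ‖f y‖ * ‖g (y⁻¹ * x)‖ * w x
      ≤ ‖f y‖ * ‖g (y⁻¹ * x)‖ * (w y * w (y⁻¹ * x)) :=
        mul_le_mul_of_nonneg_left (weight_le w x y) (by positivity)
    _ = _ := by ring

theorem summable_major (f g : WeightedL1 w) : Summable fun p : G × G =>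
    (‖f p.1‖ * w p.1) * (‖g (p.1⁻¹ * p.2)‖ * w (p.1⁻¹ * p.2)) :=
  summable_shear f.summable g.summable f.term_nonneg g.term_nonneg

theorem summable_conv_weight (f g : WeightedL1 w) :
    Summable fun p : G × G => ‖f p.1 * g (p.1⁻¹ * p.2)‖ * w p.2 :=
  Summable.of_nonneg_of_le (fun p => mul_nonneg (norm_nonneg _) (w.pos p.2).le)
    (fun p => conv_term_le f g p.2 p.1) (summable_major f g)

theorem summable_conv (f g : WeightedL1 w) (x : G) :
    Summable fun y => f y * g (y⁻¹ * x) := by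
  have h1 : Summable fun y => ‖f y * g (y⁻¹ * x)‖ * w x :=
    (summable_conv_weight f g).comp_injective (i := fun y => (y, x))
      (fun a b h => congrArg Prod.fst h)
  exact ((summable_mul_right_iff (w.pos x).ne').1 h1).of_norm

theorem summable_conv_swap (f g : WeightedL1 w) :
    Summable fun p : G × G => ‖f p.2 * g (p.2⁻¹ * p.1)‖ * w p.1 :=
  (Equiv.prodComm G G).summable_iff.1 (summable_conv_weight f g)

theorem conv_norm_le (f g : WeightedL1 w) (x : G) :
    ‖∑' y, f y * g (y⁻¹ * x)‖ * w x ≤ ∑' y, ‖f y * g (y⁻¹ * x)‖ * w x := by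
  rw [tsum_mul_right]
  exact mul_le_mul_of_nonneg_right (norm_tsum_le_tsum_norm (summable_conv f g x).norm)
    (w.pos x).le

/-- Multiplication is convolution, `(f * g) x = ∑ f y g (y⁻¹ x)`. -/
instance : Mul (WeightedL1 w) where
  mul f g := ⟨fun x => ∑' y, f y * g (y⁻¹ * x),
    Summable.of_nonneg_of_le (fun x => mul_nonneg (norm_nonneg _) (w.pos x).le)
      (conv_norm_le f g) (summable_conv_swap f g).prod⟩

theorem mul_apply (f g : WeightedL1 w) (x : G) : (f * g) x = ∑' y, f y * g (y⁻¹ * x) := rfl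

open Classical in
/-- The unit is the point mass at the identity. -/
instance : One (WeightedL1 w) where
  one := ⟨Pi.single 1 1, summable_of_ne_finset_zero (s := {1}) (by
    intro x hx
    have : x ≠ 1 := by simpa using hx
    simp [this])⟩

open Classical in
theorem one_apply (x : G) : (1 : WeightedL1 w) x = if x = 1 then 1 else 0 :=
  Pi.single_apply (1 : G) (1 : ℂ) x

theorem norm_conv_le (f g : WeightedL1 w) : ‖f * g‖ ≤ ‖f‖ * ‖g‖ := by
  have hM := summable_major f g
  calc ‖f * g‖ ≤ ∑' x, ∑' y, ‖f y * g (y⁻¹ * x)‖ * w x :=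
        (f * g).summable.tsum_le_tsum (conv_norm_le f g) (summable_conv_swap f g).prod
    _ = ∑' p : G × G, ‖f p.2 * g (p.2⁻¹ * p.1)‖ * w p.1 :=
        ((summable_conv_swap f g).tsum_prod).symm
    _ = ∑' p : G × G, ‖f p.1 * g (p.1⁻¹ * p.2)‖ * w p.2 :=
        ((Equiv.prodComm G G).tsum_eq
          (fun p : G × G => ‖f p.1 * g (p.1⁻¹ * p.2)‖ * w p.2))
    _ ≤ ∑' p : G × G, (‖f p.1‖ * w p.1) * (‖g (p.1⁻¹ * p.2)‖ * w (p.1⁻¹ * p.2)) :=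
        (summable_conv_weight f g).tsum_le_tsum (fun p => conv_term_le f g p.2 p.1) hM
    _ = ∑' y, ∑' x, (‖f y‖ * w y) * (‖g (y⁻¹ * x)‖ * w (y⁻¹ * x)) := hM.tsum_prod
    _ = ∑' y, (‖f y‖ * w y) * ‖g‖ := by
        refine tsum_congr fun y => ?_
        rw [tsum_mul_left, norm_def]
        congr 1
        exact (Equiv.mulLeft y⁻¹).tsum_eq (fun z => ‖g z‖ * w z)
    _ = ‖f‖ * ‖g‖ := by rw [tsum_mul_right, ← norm_def]

theorem conv_assoc (f g h : WeightedL1 w) : f * g * h = f * (g * h) := by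
  ext x
  have hS : Summable fun p : G × G => f p.1 * g (p.1⁻¹ * p.2) * h (p.2⁻¹ * x) := by
    have h1 : Summable fun p : G × G => ‖f p.1 * g (p.1⁻¹ * p.2) * h (p.2⁻¹ * x)‖ * w x := by
      refine Summable.of_nonneg_of_le (fun p => mul_nonneg (norm_nonneg _) (w.pos x).le)
        (fun p => ?_) ((summable_conv_weight f g).mul_right ‖h‖)
      have h2 := h.term_le_norm (p.2⁻¹ * x)
      rw [norm_mul (f p.1 * g (p.1⁻¹ * p.2))]
      calc ‖f p.1 * g (p.1⁻¹ * p.2)‖ * ‖h (p.2⁻¹ * x)‖ * w x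
          ≤ ‖f p.1 * g (p.1⁻¹ * p.2)‖ * ‖h (p.2⁻¹ * x)‖ * (w p.2 * w (p.2⁻¹ * x)) :=
            mul_le_mul_of_nonneg_left (weight_le w x p.2) (by positivity)
        _ = ‖f p.1 * g (p.1⁻¹ * p.2)‖ * w p.2 * (‖h (p.2⁻¹ * x)‖ * w (p.2⁻¹ * x)) := by ring
        _ ≤ _ := mul_le_mul_of_nonneg_left h2 (mul_nonneg (norm_nonneg _) (w.pos _).le)
    exact ((summable_mul_right_iff (w.pos x).ne').1 h1).of_norm
  calc (f * g * h) x = ∑' z, ∑' y, f y * g (y⁻¹ * z) * h (z⁻¹ * x) := by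
        simp only [mul_apply]
        exact tsum_congr fun z => tsum_mul_right.symm
    _ = ∑' y, ∑' z, f y * g (y⁻¹ * z) * h (z⁻¹ * x) := by
        exact Summable.tsum_comm (f := fun y z => f y * g (y⁻¹ * z) * h (z⁻¹ * x)) hS
    _ = (f * (g * h)) x := by
        simp only [mul_apply]
        refine tsum_congr fun y => ?_
        rw [← tsum_mul_left,
          ← (Equiv.mulLeft y⁻¹).tsum_eq (fun z => f y * (g z * h (z⁻¹ * (y⁻¹ * x))))]
        refine tsum_congr fun z => ?_
        simp [mul_assoc]

theorem conv_one_mul (f : WeightedL1 w) : 1 * f = f := by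
  ext x
  rw [mul_apply, tsum_eq_single 1]
  · simp [one_apply]
  · intro y hy
    simp [one_apply, hy]

theorem conv_mul_one (f : WeightedL1 w) : f * 1 = f := by
  ext x
  rw [mul_apply, tsum_eq_single x]
  · simp [one_apply]
  · intro y hy
    have : y⁻¹ * x ≠ 1 := fun h => hy (inv_mul_eq_one.1 h)
    simp [one_apply, this]

theorem conv_mul_add (f g h : WeightedL1 w) : f * (g + h) = f * g + f * h := by
  ext x
  simp only [mul_apply, add_apply, mul_add]
  exact (summable_conv f g x).tsum_add (summable_conv f h x)

theorem conv_add_mul (f g h : WeightedL1 w) : (f + g) * h = f * h + g * h := by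
  ext x
  simp only [mul_apply, add_apply, add_mul]
  exact (summable_conv f h x).tsum_add (summable_conv g h x)

instance : NormedRing (WeightedL1 w) :=
  { (inferInstance : NormedAddCommGroup (WeightedL1 w)) with
    mul := (· * ·)
    one := 1
    left_distrib := conv_mul_add
    right_distrib := conv_add_mul
    zero_mul := fun f => by ext x; simp [mul_apply]
    mul_zero := fun f => by ext x; simp [mul_apply]
    mul_assoc := conv_assoc
    one_mul := conv_one_mul
    mul_one := conv_mul_one
    norm_mul_le := norm_conv_le }

instance : Algebra ℂ (WeightedL1 w) :=
  Algebra.ofModule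
    (fun c f g => by
      ext x
      simp only [mul_apply, smul_apply, mul_assoc]
      exact tsum_mul_left)
    (fun c f g => by
      ext x
      simp only [mul_apply, smul_apply, mul_left_comm _ c]
      exact tsum_mul_left)

instance : NormedAlgebra ℂ (WeightedL1 w) where
  norm_smul_le c f := (normedSpaceCore.norm_smul c f).le

end WeightedL1

/-- The algebraic centre of a normed algebra, with the restricted norm, is a commutative normed
algebra. -/
instance centerNormedCommRing (A : Type u) [NormedRing A] [NormedAlgebra ℂ A] :
    NormedCommRing (Subalgebra.center ℂ A) :=
  { (inferInstance : NormedRing (Subalgebra.center ℂ A)) with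
    mul_comm := fun a b => Subtype.ext ((Subalgebra.mem_center_iff.1 b.2) a.1) }

/-! ### `Q`-algebras and the multi-variable von Neumann inequality -/

/-- A uniform algebra on the compact space `X`: a closed (unital) subalgebra of `C(X)` that
separates the points of `X`. -/
structure IsUniformAlgebra {X : Type u} [TopologicalSpace X] [CompactSpace X]
    (B : Subalgebra ℂ C(X, ℂ)) : Prop where
  isClosed : IsClosed (B : Set C(X, ℂ))
  separatesPoints : B.SeparatesPoints

/-- `A` is isomorphic, by a bicontinuous algebra isomorphism, to a `Q`-algebra, i.e. to the
quotient of a uniform algebra by a closed ideal. -/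
def IsIsomorphicToQAlgebra (A : Type u) [NormedCommRing A] [NormedAlgebra ℂ A] : Prop :=
  ∃ (X : Type u) (_ : TopologicalSpace X) (_ : CompactSpace X) (_ : T2Space X)
    (B : Subalgebra ℂ C(X, ℂ)) (I : Ideal B) (T : (B ⧸ I) ≃ₐ[ℂ] A),
    IsUniformAlgebra B ∧ IsClosed (I : Set B) ∧ Continuous T ∧ Continuous T.symm

/-- The supremum of `|p|` over the closed unit polydisc. -/
def polydiscNorm {n : ℕ} (p : MvPolynomial (Fin n) ℂ) : ℝ :=
  sSup ((fun z : Fin n → ℂ => ‖MvPolynomial.eval z p‖) '' {z | ∀ i, ‖z i‖ ≤ 1})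

/-- The multi-variable `(δ, L)`-von Neumann inequality. -/
def SatisfiesVonNeumann (A : Type u) [NormedCommRing A] [NormedAlgebra ℂ A] (δ L : ℝ) : Prop :=
  ∀ (n : ℕ) (a : Fin n → A), (∀ i, ‖a i‖ ≤ δ) →
    ∀ p : MvPolynomial (Fin n) ℂ, MvPolynomial.constantCoeff p = 0 →
      ‖MvPolynomial.aeval a p‖ ≤ L * polydiscNorm p

/-! ### Growth, length function, exponential weights -/

/-- A finite symmetric generating set containing the identity. -/
structure SymmGenSet (G : Type u) [Group G] where
  carrier : Set G
  finite : carrier.Finite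
  one_mem : 1 ∈ carrier
  inv_mem : ∀ x ∈ carrier, x⁻¹ ∈ carrier
  closure_eq_top : Subgroup.closure carrier = ⊤

namespace SymmGenSet

variable {G : Type u} [Group G] (F : SymmGenSet G)

/-- `|Fⁿ|`. -/
def growth (n : ℕ) : ℕ := (F.carrier ^ n).ncard

/-- Polynomial growth: `|Fⁿ|` is bounded by a polynomial in `n`. -/
def HasPolynomialGrowth : Prop :=
  ∃ g : ℝ[X], ∀ n : ℕ, (F.growth n : ℝ) ≤ g.eval (n : ℝ)

/-- The order of growth: the least degree of a polynomial bounding `|Fⁿ|`. -/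
def growthOrder : ℕ :=
  sInf {k | ∃ g : ℝ[X], g.natDegree = k ∧ ∀ n : ℕ, (F.growth n : ℝ) ≤ g.eval (n : ℝ)}

/-- The length function of `F`, the least `n` with `x ∈ Fⁿ` (here `F⁰ = {1}`). -/
def length (x : G) : ℕ := sInf {n | x ∈ F.carrier ^ n}

theorem exists_mem_pow (x : G) : ∃ n, x ∈ F.carrier ^ n := by
  have hx : x ∈ Subgroup.closure F.carrier := by rw [F.closure_eq_top]; trivial
  induction hx using Subgroup.closure_induction with
  | mem x hx => exact ⟨1, by simpa using hx⟩
  | one => exact ⟨0, by simp⟩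
  | mul x y _ _ hx hy =>
    obtain ⟨m, hm⟩ := hx
    obtain ⟨n, hn⟩ := hy
    exact ⟨m + n, by rw [pow_add]; exact Set.mul_mem_mul hm hn⟩
  | inv x _ hx =>
    obtain ⟨n, hn⟩ := hx
    refine ⟨n, ?_⟩
    have h : F.carrier⁻¹ = F.carrier := by
      ext y
      exact ⟨fun hy => by simpa using F.inv_mem _ hy, fun hy => F.inv_mem _ hy⟩
    have h2 : x⁻¹ ∈ (F.carrier ^ n)⁻¹ := by simpa using hn
    rwa [← inv_pow, h] at h2

theorem mem_pow_length (x : G) : x ∈ F.carrier ^ F.length x := Nat.sInf_mem (F.exists_mem_pow x)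

theorem length_mul_le (x y : G) : F.length (x * y) ≤ F.length x + F.length y :=
  Nat.sInf_le (by
    show x * y ∈ F.carrier ^ (F.length x + F.length y)
    rw [pow_add]
    exact Set.mul_mem_mul (F.mem_pow_length x) (F.mem_pow_length y))

/-- The exponential weight `x ↦ exp (C τ(x)^α)`, where `τ` is the length function of `F`. -/
def expWeight {α C : ℝ} (hα0 : 0 < α) (hα1 : α < 1) (hC : 0 < C) : Weight G where
  toFun x := Real.exp (C * (F.length x : ℝ) ^ α)
  pos' x := Real.exp_pos _
  submul' x y := by
    rw [← Real.exp_add, Real.exp_le_exp, ← mul_add]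
    refine mul_le_mul_of_nonneg_left ?_ hC.le
    calc (F.length (x * y) : ℝ) ^ α ≤ ((F.length x : ℝ) + F.length y) ^ α :=
          Real.rpow_le_rpow (Nat.cast_nonneg _) (by exact_mod_cast F.length_mul_le x y) hα0.le
      _ ≤ _ := Real.rpow_add_le_add_rpow (Nat.cast_nonneg _) (Nat.cast_nonneg _) hα0.le hα1.le

end SymmGenSet

/-! ### The constants -/

/-- The (complex) Grothendieck constant: the least `K` such that, for every complex matrix `a`
with `|∑ aᵢⱼ sᵢ tⱼ| ≤ 1` for all scalars of modulus at most one, one has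
`|∑ aᵢⱼ ⟨xᵢ, yⱼ⟩| ≤ K` for all vectors in the unit ball of a complex Hilbert space. -/
def grothendieckConstant : ℝ≥0∞ :=
  sInf {K : ℝ≥0∞ | ∀ (m n : ℕ) (a : Matrix (Fin m) (Fin n) ℂ),
    (∀ (s : Fin m → ℂ) (t : Fin n → ℂ), (∀ i, ‖s i‖ ≤ 1) → (∀ j, ‖t j‖ ≤ 1) →
      ‖∑ i, ∑ j, a i j * s i * t j‖ ≤ 1) →
    ∀ (H : Type) [NormedAddCommGroup H] [InnerProductSpace ℂ H] [CompleteSpace H]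
      (x : Fin m → H) (y : Fin n → H), (∀ i, ‖x i‖ ≤ 1) → (∀ j, ‖y j‖ ≤ 1) →
      ENNReal.ofReal ‖∑ i, ∑ j, a i j * inner ℂ (x i) (y j)‖ ≤ K}

/-- `p(x) = C x^α - β log (1 + x)`. -/
def expPolyGap (α C β x : ℝ) : ℝ := C * x ^ α - β * Real.log (1 + x)

/-- `K = (β² / (C α (1 - α)))^(1/α)`. -/
def thresholdK (α C β : ℝ) : ℝ := (β ^ 2 / (C * α * (1 - α))) ^ (1 / α)

/-- `M = max {exp (p(t) - p(s) - p(r)) : t, s, r ∈ [0, 4K] ∩ ℤ}` (a maximum over a finite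
nonempty set). -/
def boundM (α C β : ℝ) : ℝ :=
  sSup {v | ∃ t s r : ℕ, (t : ℝ) ≤ 4 * thresholdK α C β ∧ (s : ℝ) ≤ 4 * thresholdK α C β ∧
    (r : ℝ) ≤ 4 * thresholdK α C β ∧
    v = Real.exp (expPolyGap α C β t - expPolyGap α C β s - expPolyGap α C β r)}

/-- `∑_{n ≥ 1} (f(n) - lam f(n-1)) / (1+n)^(2β)`, a series of nonnegative terms (when
`lam f ≤ |Fⁿ| ≤ f`) with sum in `[0, ∞]`; the summation index is shifted by one. -/
def growthSeries (f : ℝ[X]) (lam β : ℝ) : ℝ≥0∞ :=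
  ∑' n : ℕ, ENNReal.ofReal
    ((f.eval ((n : ℝ) + 1) - lam * f.eval (n : ℝ)) / (1 + ((n : ℝ) + 1)) ^ (2 * β))

/-- `δ = e⁻¹ (1 + K_G M 2^(β-1) [1 + ∑ (f(n) - lam f(n-1)) / (1+n)^(2β)]^(1/2))⁻¹`; it is `0` if
the series diverges. -/
def vonNeumannRadius (α C β lam : ℝ) (f : ℝ[X]) : ℝ :=
  (Real.exp 1)⁻¹ *
    ((1 + grothendieckConstant * ENNReal.ofReal (boundM α C β * 2 ^ (β - 1)) *
      (1 + growthSeries f lam β) ^ (1 / 2 : ℝ))⁻¹).toReal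

end

noncomputable section

/-! ### Polynomials bounded on the polydisc -/

/-! Suppose multiplication in a commutative algebra is bounded by κ for the injective tensor norm
(`IsInjectiveAlgebra`). Euler's identity writes a homogeneous P as (1/deg P) ∑ x_j ∂_j P, Cauchy's
estimate bounds the directional derivatives of P by e · deg P · sup|P|, and induction on the degree
gives ‖P(a)‖ ≤ δ (eκδ)^(deg P - 1) sup|P| when all ‖a_i‖ ≤ δ. Summed over the homogeneous components
this is a geometric series, at most sup|P| once δ(1 + eκ) ≤ 1 (`IsInjectiveAlgebra.norm_aeval_le`).
Such an inequality in turn exhibits a Banach algebra as a quotient of a uniform algebra on a large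
polydisc (`isIsomorphicToQAlgebra_of_norm_aeval_le`). The injective bound passes to the centre, so
only ℓ¹(G, w) has to be studied.

There the question is about matrices: if w(xy) ≤ Ω(x,y) w(x) w(y), it suffices to bound ∑ |a(x,y)|
Ω(x,y) by κ times the norm of a as a bilinear form on sup-norm balls (`MatrixBound`,
`isInjectiveAlgebra_of_matrixBound`). Concavity of n ↦ n^α allows Ω to be the larger of
exp(-C(1-α)τ^α) at x and at y. Polynomial growth makes this function summable on G, which already
gives the Q-algebra statement.

For the explicit δ, the decay off the identity is compared with (M/8)(1+τ)^(-β), whose squares sum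
to at most the growth series; the Grothendieck constant handles square summable weights
(`MatrixBound.of_sum_sq_le`), and the row and column of the identity are treated apart. If the
Grothendieck constant or the series is infinite then δ = 0, so Grothendieck's theorem itself is
never needed. -/

theorem MvPolynomial.hasDerivAt_eval_line {n : ℕ} (z t : Fin n → ℂ) (P : MvPolynomial (Fin n) ℂ)
    (l : ℂ) :
    HasDerivAt (fun l : ℂ => MvPolynomial.eval (fun i => z i + l * t i) P)
      (∑ j, t j * MvPolynomial.eval (fun i => z i + l * t i) (MvPolynomial.pderiv j P)) l := by
  induction P using MvPolynomial.induction_on with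
  | C a => simpa using hasDerivAt_const l a
  | add p q hp hq =>
    simp only [map_add, mul_add, Finset.sum_add_distrib]
    exact hp.add hq
  | mul_X p i hp =>
    have h1 : HasDerivAt (fun l : ℂ => z i + l * t i) (t i) l := by
      simpa using ((hasDerivAt_id l).mul_const (t i)).const_add (z i)
    simp only [map_mul, MvPolynomial.eval_X]
    refine (hp.mul h1).congr_deriv (Eq.symm ?_)
    · classical
      have h2 : ∀ j, t j * MvPolynomial.eval (fun i => z i + l * t i)
          (MvPolynomial.pderiv j (p * MvPolynomial.X i)) =
            t j * MvPolynomial.eval (fun i => z i + l * t i) (MvPolynomial.pderiv j p)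
            * (z i + l * t i) + if j = i then
              MvPolynomial.eval (fun i => z i + l * t i) p * t i else 0 := by
        intro j
        rw [Derivation.leibniz, MvPolynomial.pderiv_X]
        by_cases hj : j = i
        · subst hj; simp; ring
        · simp [hj, Ne.symm hj]; ring
      simp only [h2, Finset.sum_add_distrib, Finset.sum_ite_eq', Finset.mem_univ, if_true,
        Finset.sum_mul]

theorem MvPolynomial.IsHomogeneous.eval_smul' {n m : ℕ} {P : MvPolynomial (Fin n) ℂ}
    (hP : P.IsHomogeneous m) (c : ℂ) (z : Fin n → ℂ) :
    MvPolynomial.eval (fun i => c * z i) P = c ^ m * MvPolynomial.eval z P := by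
  rw [MvPolynomial.eval_eq', MvPolynomial.eval_eq', Finset.mul_sum]
  refine Finset.sum_congr rfl fun d hd => ?_
  have h : ∑ i, d i = m := by
    have := hP (MvPolynomial.mem_support_iff.1 hd)
    simpa [Finsupp.weight_apply, Finsupp.sum_fintype] using this
  simp only [mul_pow, Finset.prod_mul_distrib, Finset.prod_pow_eq_pow_sum, h]
  ring

/-- The directional derivative of a homogeneous polynomial on the polydisc. -/
theorem norm_sum_pderiv_le {n m : ℕ} {P : MvPolynomial (Fin n) ℂ} (hP : P.IsHomogeneous (m + 2))
    {R : ℝ} (hR : ∀ z : Fin n → ℂ, (∀ i, ‖z i‖ ≤ 1) → ‖MvPolynomial.eval z P‖ ≤ R)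
    (z t : Fin n → ℂ) (hz : ∀ i, ‖z i‖ ≤ 1) (ht : ∀ i, ‖t i‖ ≤ 1) :
    ‖∑ j, t j * MvPolynomial.eval z (MvPolynomial.pderiv j P)‖ ≤ (m + 2) * Real.exp 1 * R := by
  have hR0 : 0 ≤ R := (norm_nonneg _).trans (hR 0 (by simp))
  -- This radius minimises the Cauchy bound (1+r)^(m+2)/r, turning it into (m+2)(1 + 1/(m+1))^(m+1)
  -- ≤ (m+2)e.
  set r : ℝ := ((m + 1 : ℕ) : ℝ)⁻¹ with hr
  have hr0 : 0 < r := by positivity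
  have hd := MvPolynomial.hasDerivAt_eval_line z t P
  have hbound : ∀ l ∈ Metric.sphere (0 : ℂ) r,
      ‖MvPolynomial.eval (fun i => z i + l * t i) P‖ ≤ (1 + r) ^ (m + 2) * R := by
    intro l hl
    have hl' : ‖l‖ = r := by simpa using hl
    have hne : ((1 + r : ℝ) : ℂ) ≠ 0 := by exact_mod_cast (by positivity : (1 + r) ≠ 0)
    have h1 : (fun i => z i + l * t i)
        = fun i => ((1 + r : ℝ) : ℂ) * (((1 + r : ℝ) : ℂ)⁻¹ * (z i + l * t i)) := by
      ext i; field_simp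
    rw [h1, hP.eval_smul', norm_mul, norm_pow, Complex.norm_real, Real.norm_of_nonneg (by positivity)]
    refine mul_le_mul_of_nonneg_left (hR _ fun i => ?_) (by positivity)
    rw [norm_mul, norm_inv, Complex.norm_real, Real.norm_of_nonneg (by positivity : 0 ≤ 1 + r),
      inv_mul_le_iff₀ (by positivity), mul_one]
    refine (norm_add_le _ _).trans (add_le_add (hz i) ?_)
    rw [norm_mul, hl']
    exact mul_le_of_le_one_right hr0.le (ht i)
  have hdiff : Differentiable ℂ fun l : ℂ => MvPolynomial.eval (fun i => z i + l * t i) P :=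
    fun l => (hd l).differentiableAt
  have hc := Complex.norm_deriv_le_of_forall_mem_sphere_norm_le hr0
    (hdiff.diffContOnCl) hbound
  rw [(hd 0).deriv] at hc
  simp only [zero_mul, add_zero] at hc
  refine hc.trans ?_
  have he : (1 + r) ^ (m + 1) ≤ Real.exp 1 := Real.one_add_inv_pow_le_exp
  have h2 : (1 + r) / r = m + 2 := by
    rw [hr]; push_cast; field_simp; ring
  calc (1 + r) ^ (m + 2) * R / r = ((1 + r) / r) * (1 + r) ^ (m + 1) * R := by ring
    _ ≤ (m + 2) * Real.exp 1 * R := by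
      rw [h2]; gcongr

/-- The component of degree m at z is the m-th Taylor coefficient of l ↦ P(lz), so Cauchy's estimate
on the unit circle applies. -/
theorem norm_eval_homogeneousComponent_le {n : ℕ} {P : MvPolynomial (Fin n) ℂ}
    {R : ℝ} (hR : ∀ z : Fin n → ℂ, (∀ i, ‖z i‖ ≤ 1) → ‖MvPolynomial.eval z P‖ ≤ R)
    (m : ℕ) (z : Fin n → ℂ) (hz : ∀ i, ‖z i‖ ≤ 1) :
    ‖MvPolynomial.eval z (MvPolynomial.homogeneousComponent m P)‖ ≤ R := by
  have hR0 : 0 ≤ R := (norm_nonneg _).trans (hR 0 (by simp))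
  by_cases hm : P.totalDegree < m
  · simpa [MvPolynomial.homogeneousComponent_eq_zero _ _ hm] using hR0
  have hg : (fun l : ℂ => MvPolynomial.eval (fun i => l * z i) P) = fun l : ℂ =>
      ∑ k ∈ Finset.range (P.totalDegree + 1),
        MvPolynomial.eval z (MvPolynomial.homogeneousComponent k P) * l ^ k := by
    ext l
    conv_lhs => rw [← MvPolynomial.sum_homogeneousComponent P]
    rw [map_sum]
    refine Finset.sum_congr rfl fun k _ => ?_
    rw [(MvPolynomial.homogeneousComponent_isHomogeneous k P).eval_smul', mul_comm]
  have hdiff : Differentiable ℂ fun l : ℂ => MvPolynomial.eval (fun i => l * z i) P := by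
    rw [hg]; fun_prop
  have hc := Complex.norm_iteratedDeriv_le_of_forall_mem_sphere_norm_le (c := 0) (R := 1) (C := R)
    m one_pos hdiff.diffContOnCl (fun l hl => hR _ fun i => by
      rw [norm_mul, mem_sphere_zero_iff_norm.1 hl, one_mul]; exact hz i)
  rw [hg, iteratedDeriv_fun_sum (fun k _ => by fun_prop)] at hc
  simp only [iteratedDeriv_const_mul_field, iteratedDeriv_fun_pow_zero] at hc
  rw [Finset.sum_eq_single m (fun k _ hk => by simp [hk.symm])
    (fun h => absurd (Finset.mem_range.2 (by omega)) h)] at hc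
  simp only [if_true, norm_mul, Complex.norm_natCast, one_pow, div_one] at hc
  rw [mul_comm] at hc
  exact le_of_mul_le_mul_left hc (by positivity)

theorem norm_eval_le_polydiscNorm {n : ℕ} (P : MvPolynomial (Fin n) ℂ) (z : Fin n → ℂ)
    (hz : ∀ i, ‖z i‖ ≤ 1) : ‖MvPolynomial.eval z P‖ ≤ polydiscNorm P := by
  have hc : IsCompact {z : Fin n → ℂ | ∀ i, ‖z i‖ ≤ 1} := by
    have := isCompact_univ_pi (fun _ : Fin n => isCompact_closedBall (0 : ℂ) 1)
    convert this using 1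
    ext z; simp [Set.mem_pi]
  exact le_csSup (hc.bddAbove_image (MvPolynomial.continuous_eval P).norm.continuousOn) ⟨z, hz, rfl⟩

/-! ### Algebras whose multiplication is bounded for the injective norm -/

/-- Multiplication is bounded by `κ` for the injective tensor norm. -/
def IsInjectiveAlgebra (A : Type*) [NormedRing A] [NormedAlgebra ℂ A] (κ : ℝ) : Prop :=
  ∀ (n : ℕ) (c a : Fin n → A) (δ R : ℝ), 0 ≤ δ → (∀ j, ‖a j‖ ≤ δ) →
    (∀ t : Fin n → ℂ, (∀ j, ‖t j‖ ≤ 1) → ‖∑ j, t j • c j‖ ≤ R) →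
    ‖∑ j, c j * a j‖ ≤ κ * δ * R

theorem exists_unimodular_mul_eq_norm (c : ℂ) : ∃ t : ℂ, ‖t‖ ≤ 1 ∧ t * c = ‖c‖ := by
  by_cases hc : c = 0
  · exact ⟨0, by simp, by simp [hc]⟩
  · have h : (‖c‖ : ℂ) ≠ 0 := by simpa using hc
    refine ⟨(starRingEnd ℂ) c / ‖c‖, by simp [div_self, hc], ?_⟩
    rw [div_mul_eq_mul_div, mul_comm, Complex.mul_conj, Complex.normSq_eq_norm_sq]
    field_simp
    push_cast
    ring

section Commutative

variable {A : Type u} [NormedCommRing A] [NormedAlgebra ℂ A]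

/-- Euler's identity splits off one factor `a j`, giving the sum of products to which
`IsInjectiveAlgebra` applies. -/
theorem aeval_eq_sum_pderiv_mul {n k : ℕ} {P : MvPolynomial (Fin n) ℂ} (hP : P.IsHomogeneous k)
    {c : ℂ} (hc : c * k = 1) (a : Fin n → A) :
    MvPolynomial.aeval a P = ∑ j, (c • MvPolynomial.aeval a (MvPolynomial.pderiv j P)) * a j := by
  have h1 := congrArg (MvPolynomial.aeval a) hP.sum_X_mul_pderiv
  rw [map_sum, map_nsmul, ← Nat.cast_smul_eq_nsmul ℂ] at h1
  calc MvPolynomial.aeval a P = c • ((k : ℂ) • MvPolynomial.aeval a P) := by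
        rw [smul_smul, hc, one_smul]
    _ = _ := by
      rw [← h1, Finset.smul_sum]
      refine Finset.sum_congr rfl fun j _ => ?_
      rw [map_mul, MvPolynomial.aeval_X, smul_mul_assoc, mul_comm (a j)]

/-- The sup norm of a linear form on the polydisc is the ℓ¹ norm of its coefficients, so the
triangle inequality suffices. -/
theorem norm_aeval_le_of_isHomogeneous_one {δ : ℝ} {n : ℕ} (a : Fin n → A)
    (ha : ∀ i, ‖a i‖ ≤ δ) {P : MvPolynomial (Fin n) ℂ} {R : ℝ} (hP : P.IsHomogeneous 1)
    (hR : ∀ z : Fin n → ℂ, (∀ i, ‖z i‖ ≤ 1) → ‖MvPolynomial.eval z P‖ ≤ R) (hδ : 0 ≤ δ) :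
    ‖MvPolynomial.aeval a P‖ ≤ δ * R := by
  have hpd : ∀ j, ∃ c, MvPolynomial.pderiv j P = MvPolynomial.C c := fun j =>
    ⟨_, MvPolynomial.totalDegree_eq_zero_iff_eq_C.1
      (Nat.le_zero.1 ((hP.pderiv (i := j)).totalDegree_le))⟩
  choose c hc using hpd
  have hE := hP.sum_X_mul_pderiv
  simp only [one_smul, hc] at hE
  choose t ht1 ht2 using fun j => exists_unimodular_mul_eq_norm (c j)
  have h1 := hR t ht1
  rw [← hE] at h1 ⊢
  simp only [map_sum, map_mul, MvPolynomial.eval_X, MvPolynomial.eval_C, ht2] at h1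
  rw [← Complex.ofReal_sum, Complex.norm_real,
    Real.norm_of_nonneg (Finset.sum_nonneg fun _ _ => norm_nonneg _)] at h1
  calc ‖MvPolynomial.aeval a (∑ j, MvPolynomial.X j * MvPolynomial.C (c j))‖
      = ‖∑ j, c j • a j‖ := by
        simp only [map_sum, map_mul, MvPolynomial.aeval_X, MvPolynomial.aeval_C,
          Algebra.smul_def, mul_comm]
    _ ≤ ∑ j, ‖c j‖ * δ := (norm_sum_le _ _).trans (Finset.sum_le_sum fun j _ => by
        rw [norm_smul]; exact mul_le_mul_of_nonneg_left (ha j) (norm_nonneg _))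
    _ = δ * ∑ j, ‖c j‖ := by rw [← Finset.sum_mul, mul_comm]
    _ ≤ δ * R := mul_le_mul_of_nonneg_left h1 hδ

/-- Each degree costs eκδ: κδ from splitting off one factor by Euler's identity, and e because for
fixed t the polynomial (1/deg P) ∑ t_j ∂_j P has sup norm at most eR, to which the induction
hypothesis applies. -/
theorem norm_aeval_le_of_isHomogeneous {κ : ℝ} (hA : IsInjectiveAlgebra A κ) {δ : ℝ}
    (hδ : 0 ≤ δ) {n : ℕ} (a : Fin n → A) (ha : ∀ i, ‖a i‖ ≤ δ) (m : ℕ) :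
    ∀ (P : MvPolynomial (Fin n) ℂ) (R : ℝ), P.IsHomogeneous (m + 1) →
    (∀ z : Fin n → ℂ, (∀ i, ‖z i‖ ≤ 1) → ‖MvPolynomial.eval z P‖ ≤ R) →
    ‖MvPolynomial.aeval a P‖ ≤ δ * (Real.exp 1 * κ * δ) ^ m * R := by
  induction m with
  | zero =>
    intro P R hP hR
    simpa using norm_aeval_le_of_isHomogeneous_one a ha hP hR hδ
  | succ m ih =>
    intro P R hP hR
    obtain ⟨c, hc⟩ : ∃ c : ℂ, c * (m + 1 + 1 : ℕ) = 1 :=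
      ⟨_, inv_mul_cancel₀ (Nat.cast_ne_zero.2 (Nat.succ_ne_zero _))⟩
    have hcn : ‖c‖ * (m + 2) = 1 := by
      have := congrArg norm hc
      rw [norm_mul, Complex.norm_natCast, norm_one] at this
      push_cast at this
      linarith
    rw [aeval_eq_sum_pderiv_mul hP hc]
    refine (hA n _ a δ (δ * (Real.exp 1 * κ * δ) ^ m * (Real.exp 1 * R)) hδ ha ?_).trans
      (le_of_eq (by ring))
    intro t ht
    have h3 : ∑ j, t j • c • MvPolynomial.aeval a (MvPolynomial.pderiv j P)
        = MvPolynomial.aeval a (∑ j, MvPolynomial.C (t j * c) * MvPolynomial.pderiv j P) := by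
      rw [map_sum]
      refine Finset.sum_congr rfl fun j _ => ?_
      rw [map_mul, MvPolynomial.aeval_C, ← Algebra.smul_def, smul_smul]
    rw [h3]
    refine ih _ _ (MvPolynomial.IsHomogeneous.sum _ _ _ fun j _ => ?_) fun z hz => ?_
    · simpa using (MvPolynomial.isHomogeneous_C (Fin n) (t j * c)).mul (hP.pderiv (i := j))
    · have h5 : MvPolynomial.eval z (∑ j, MvPolynomial.C (t j * c) * MvPolynomial.pderiv j P)
          = c * ∑ j, t j * MvPolynomial.eval z (MvPolynomial.pderiv j P) := by
        rw [map_sum, Finset.mul_sum]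
        refine Finset.sum_congr rfl fun j _ => ?_
        rw [map_mul, MvPolynomial.eval_C]
        ring
      rw [h5, norm_mul]
      calc ‖c‖ * _ ≤ ‖c‖ * ((m + 2) * Real.exp 1 * R) :=
            mul_le_mul_of_nonneg_left (norm_sum_pderiv_le hP hR z t hz ht) (norm_nonneg _)
        _ = (‖c‖ * (m + 2)) * (Real.exp 1 * R) := by ring
        _ = _ := by rw [hcn, one_mul]

/-- The von Neumann inequality for algebras with multiplication bounded in the injective norm. -/
theorem IsInjectiveAlgebra.norm_aeval_le {κ : ℝ} (hA : IsInjectiveAlgebra A κ) {δ : ℝ}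
    (hδ : 0 ≤ δ) (hκ : 0 ≤ κ) (hδκ : δ * (1 + Real.exp 1 * κ) ≤ 1) {n : ℕ} (a : Fin n → A)
    (ha : ∀ i, ‖a i‖ ≤ δ) (P : MvPolynomial (Fin n) ℂ) (hP : MvPolynomial.constantCoeff P = 0)
    {R : ℝ} (hR : ∀ z : Fin n → ℂ, (∀ i, ‖z i‖ ≤ 1) → ‖MvPolynomial.eval z P‖ ≤ R) :
    ‖MvPolynomial.aeval a P‖ ≤ R := by
  have hR0 : 0 ≤ R := (norm_nonneg _).trans (hR 0 (by simp))
  set r : ℝ := Real.exp 1 * κ * δ with hr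
  have hr0 : 0 ≤ r := by positivity
  rcases hδ.eq_or_lt with h0 | h0
  · have ha0 : a = fun _ => 0 := funext fun i => norm_le_zero_iff.1 (by rw [h0]; exact ha i)
    have : MvPolynomial.aeval a P = 0 := by
      rw [ha0, MvPolynomial.aeval_zero', hP, map_zero]
    rwa [this, norm_zero]
  -- The hypothesis reads δ + r ≤ 1, so δ > 0 makes the geometric series converge, with δ/(1 - r) ≤
  -- 1.
  have hr1 : r < 1 := by nlinarith
  have h1 : MvPolynomial.aeval a P = ∑ m ∈ Finset.range P.totalDegree,
      MvPolynomial.aeval a (MvPolynomial.homogeneousComponent (m + 1) P) := by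
    conv_lhs => rw [← MvPolynomial.sum_homogeneousComponent P]
    rw [map_sum, Finset.sum_range_succ', MvPolynomial.homogeneousComponent_zero]
    have : MvPolynomial.coeff 0 P = 0 := hP
    rw [this, map_zero, map_zero, add_zero]
  rw [h1]
  calc ‖_‖ ≤ ∑ m ∈ Finset.range P.totalDegree, δ * r ^ m * R :=
        (norm_sum_le _ _).trans (Finset.sum_le_sum fun m _ =>
          norm_aeval_le_of_isHomogeneous hA hδ a ha m _ R
            (MvPolynomial.homogeneousComponent_isHomogeneous _ _)
            (norm_eval_homogeneousComponent_le hR _))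
    _ = δ * (∑ m ∈ Finset.range P.totalDegree, r ^ m) * R := by
        rw [← Finset.sum_mul, Finset.mul_sum]
    _ ≤ 1 * R := by
        refine mul_le_mul_of_nonneg_right ?_ hR0
        have h2 : ∑ m ∈ Finset.range P.totalDegree, r ^ m ≤ (1 - r)⁻¹ := by
          rw [← tsum_geometric_of_lt_one hr0 hr1]
          exact (summable_geometric_of_lt_one hr0 hr1).sum_le_tsum _ fun _ _ => by positivity
        calc δ * _ ≤ δ * (1 - r)⁻¹ := mul_le_mul_of_nonneg_left h2 hδ
          _ ≤ 1 := by
            rw [← div_eq_mul_inv, div_le_one (by linarith)]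
            nlinarith
    _ = R := one_mul R

theorem IsInjectiveAlgebra.satisfiesVonNeumann {κ : ℝ} (hA : IsInjectiveAlgebra A κ) {δ : ℝ}
    (hδ : 0 ≤ δ) (hκ : 0 ≤ κ) (hδκ : δ * (1 + Real.exp 1 * κ) ≤ 1) :
    SatisfiesVonNeumann A δ 1 := fun n a ha P hP => by
  rw [one_mul]
  exact hA.norm_aeval_le hδ hκ hδκ a ha P hP (norm_eval_le_polydiscNorm P)

end Commutative

/-! ### Quotients of uniform algebras -/

section QAlgebra

variable {A : Type u} [NormedCommRing A] [NormedAlgebra ℂ A]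

/-- The coordinate functions on a polydisc. -/
def polydiscCoord (ι : Type u) (i : ι) : C(ι → Metric.closedBall (0 : ℂ) 1, ℂ) :=
  ⟨fun z => z i, by fun_prop⟩

/-- Polynomials as functions on a polydisc. -/
def polydiscEval (ι : Type u) : MvPolynomial ι ℂ →ₐ[ℂ] C(ι → Metric.closedBall (0 : ℂ) 1, ℂ) :=
  MvPolynomial.aeval (polydiscCoord ι)

theorem polydiscEval_apply (ι : Type u) (P : MvPolynomial ι ℂ)
    (z : ι → Metric.closedBall (0 : ℂ) 1) :
    polydiscEval ι P z = MvPolynomial.eval (fun i => (z i : ℂ)) P := by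
  induction P using MvPolynomial.induction_on with
  | C a => simp [polydiscEval]
  | add p q hp hq => simp [map_add, hp, hq]
  | mul_X p i hp =>
    have hX : polydiscEval ι (MvPolynomial.X i) = polydiscCoord ι i := MvPolynomial.aeval_X _ i
    rw [map_mul, map_mul, ContinuousMap.mul_apply, hp, hX, MvPolynomial.eval_X]
    rfl

/-- The hypothesis excludes constant terms: with N the sup norm, the constant term c satisfies |c| ≤
N and P - c has sup norm at most 2N, whence the factor ‖1‖ + 2. Only finitely many variables occur;
the other coordinates are set to 0. -/
theorem norm_aeval_le_norm_polydiscEval {δ : ℝ}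
    (hA : ∀ (n : ℕ) (a : Fin n → A), (∀ i, ‖a i‖ ≤ δ) → ∀ (P : MvPolynomial (Fin n) ℂ) (R : ℝ),
      MvPolynomial.constantCoeff P = 0 →
      (∀ z : Fin n → ℂ, (∀ i, ‖z i‖ ≤ 1) → ‖MvPolynomial.eval z P‖ ≤ R) →
      ‖MvPolynomial.aeval a P‖ ≤ R)
    {ι : Type u} (a : ι → A) (ha : ∀ i, ‖a i‖ ≤ δ) (P : MvPolynomial ι ℂ) :
    ‖MvPolynomial.aeval a P‖ ≤ (‖(1 : A)‖ + 2) * ‖polydiscEval ι P‖ := by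
  obtain ⟨n, f, hf, q, rfl⟩ := P.exists_fin_rename
  set N := ‖polydiscEval ι (MvPolynomial.rename f q)‖ with hN
  have hq : ∀ z : Fin n → ℂ, (∀ i, ‖z i‖ ≤ 1) → ‖MvPolynomial.eval z q‖ ≤ N := by
    intro z hz
    have h := (polydiscEval ι (MvPolynomial.rename f q)).norm_coe_le_norm
      (Function.extend f (fun i => ⟨z i, by simpa using hz i⟩) 0)
    rw [polydiscEval_apply, MvPolynomial.eval_rename] at h
    have he : ((fun i => ((Function.extend f (fun i => ⟨z i, by simpa using hz i⟩) 0 :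
        ι → Metric.closedBall (0 : ℂ) 1) i : ℂ)) ∘ f) = z := by
      ext i
      simp [hf.extend_apply]
    rwa [he] at h
  set c := MvPolynomial.constantCoeff q with hc
  have hcN : ‖c‖ ≤ N := by
    have := hq 0 (by simp)
    rwa [MvPolynomial.eval_zero] at this
  have h1 := hA n (a ∘ f) (fun i => ha _) (q - MvPolynomial.C c) (2 * N) (by simp [hc])
    (fun z hz => by
      rw [map_sub, MvPolynomial.eval_C]
      exact (norm_sub_le _ _).trans (by linarith [hq z hz]))
  rw [MvPolynomial.aeval_rename]
  have h2 : MvPolynomial.aeval (a ∘ f) q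
      = MvPolynomial.aeval (a ∘ f) (q - MvPolynomial.C c) + c • (1 : A) := by
    rw [map_sub, MvPolynomial.aeval_C, Algebra.algebraMap_eq_smul_one, sub_add_cancel]
  rw [h2]
  refine (norm_add_le _ _).trans ?_
  rw [norm_smul]
  nlinarith [norm_nonneg (1 : A)]

variable [CompleteSpace A]

/-- There is one variable for each element of the δ-ball of A. Sending each variable to its element
is bounded for the sup norm on the polydisc, hence extends to the closure B of the polynomial
functions, and A is B modulo the kernel. -/
theorem isIsomorphicToQAlgebra_of_norm_aeval_le {δ : ℝ} (hδ : 0 < δ)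
    (hA : ∀ (n : ℕ) (a : Fin n → A), (∀ i, ‖a i‖ ≤ δ) → ∀ (P : MvPolynomial (Fin n) ℂ) (R : ℝ),
      MvPolynomial.constantCoeff P = 0 →
      (∀ z : Fin n → ℂ, (∀ i, ‖z i‖ ≤ 1) → ‖MvPolynomial.eval z P‖ ≤ R) →
      ‖MvPolynomial.aeval a P‖ ≤ R) :
    IsIsomorphicToQAlgebra A := by
  let ι : Type u := {a : A // ‖a‖ ≤ δ}
  let X : Type u := ι → Metric.closedBall (0 : ℂ) 1
  let L : ℝ := ‖(1 : A)‖ + 2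
  have hbound : ∀ P : MvPolynomial ι ℂ,
      ‖MvPolynomial.aeval (fun i : ι => (i : A)) P‖ ≤ L * ‖polydiscEval ι P‖ :=
    fun P => norm_aeval_le_norm_polydiscEval hA (fun i : ι => (i : A)) (fun i => i.2) P
  let S : Subalgebra ℂ C(X, ℂ) := (polydiscEval ι).range
  let B : Subalgebra ℂ C(X, ℂ) := S.topologicalClosure
  have : IsClosed (B : Set C(X, ℂ)) := S.isClosed_topologicalClosure
  have : CompleteSpace B := IsClosed.completeSpace_coe
  -- the homomorphism on polynomial functions
  let f₀ : S →ₐ[ℂ] A :=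
    (Ideal.Quotient.liftₐ (RingHom.ker (polydiscEval ι).rangeRestrict)
      (MvPolynomial.aeval (fun i : ι => (i : A))) (fun P hP => by
        have h0 : polydiscEval ι P = 0 := congrArg Subtype.val hP
        have := hbound P
        rw [h0, norm_zero, mul_zero] at this
        exact norm_le_zero_iff.1 this)).comp
    (Ideal.quotientKerAlgEquivOfSurjective
      (polydiscEval ι).rangeRestrict_surjective).symm.toAlgHom
  have hf₀ : ∀ P, f₀ ((polydiscEval ι).rangeRestrict P)
      = MvPolynomial.aeval (fun i : ι => (i : A)) P := by
    intro P
    simp only [f₀, AlgHom.comp_apply]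
    have : (Ideal.quotientKerAlgEquivOfSurjective
      (polydiscEval ι).rangeRestrict_surjective).symm.toAlgHom ((polydiscEval ι).rangeRestrict P)
        = Ideal.Quotient.mk _ P := Ideal.quotientKerAlgEquivOfSurjective_symm_apply _ _
    rw [this]
    rfl
  have hf₀n : ∀ s, ‖f₀ s‖ ≤ L * ‖s‖ := by
    intro s
    obtain ⟨P, rfl⟩ := (polydiscEval ι).rangeRestrict_surjective s
    rw [hf₀]
    exact hbound P
  have hf₀c : UniformContinuous f₀ :=
    (AddMonoidHomClass.lipschitz_of_bound f₀ L hf₀n).uniformContinuous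
  let i₀ : S →+* B := (Subalgebra.inclusion S.le_topologicalClosure : S →ₐ[ℂ] B)
  have hi : IsUniformInducing i₀ := by
    have h1 : IsUniformInducing ((Subtype.val : B → C(X, ℂ)) ∘ i₀) :=
      isUniformInducing_val _
    exact (isUniformInducing_val _).of_comp_iff.1 h1
  have hd : DenseRange i₀ := by
    intro b
    rw [closure_subtype]
    have hb : (b : C(X, ℂ)) ∈ closure (S : Set C(X, ℂ)) := b.2
    refine closure_mono (fun s hs => ?_) hb
    exact ⟨i₀ ⟨s, hs⟩, ⟨_, rfl⟩, rfl⟩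
  let f₁ : B →+* A := IsDenseInducing.extendRingHom (f := (f₀ : S →+* A)) hi hd hf₀c
  have hf₁ : Continuous f₁ := (uniformContinuous_uniformly_extend hi hd hf₀c).continuous
  have hf₁e : ∀ s, f₁ (i₀ s) = f₀ s := fun s =>
    IsDenseInducing.extend_eq (hi.isDenseInducing hd) hf₀c.continuous s
  let f : B →ₐ[ℂ] A := { f₁ with
    commutes' := fun c => by
      have := hf₁e (algebraMap ℂ S c)
      rw [f₀.commutes] at this
      rw [← this]
      rfl }
  have hfs : Function.Surjective f := by
    intro a
    -- Scaling moves a into the δ-ball, where it is the image of a coordinate function.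
    set r : ℂ := ((δ / (‖a‖ + 1) : ℝ) : ℂ) with hr
    have hpos : 0 < ‖a‖ + 1 := by positivity
    have hr0 : r ≠ 0 := Complex.ofReal_ne_zero.2 (div_pos hδ hpos).ne'
    have hra : ‖r • a‖ ≤ δ := by
      rw [norm_smul, hr, Complex.norm_real, Real.norm_of_nonneg (div_pos hδ hpos).le,
        div_mul_eq_mul_div, div_le_iff₀ hpos]
      nlinarith
    refine ⟨r⁻¹ • i₀ ((polydiscEval ι).rangeRestrict (MvPolynomial.X ⟨r • a, hra⟩)), ?_⟩
    rw [map_smul]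
    have : f (i₀ ((polydiscEval ι).rangeRestrict (MvPolynomial.X ⟨r • a, hra⟩))) = r • a := by
      refine (hf₁e _).trans ?_
      rw [hf₀, MvPolynomial.aeval_X]
    rw [this, smul_smul, inv_mul_cancel₀ hr0, one_smul]
  -- The open mapping theorem supplies the continuity of the inverse isomorphism.
  have hopen : IsOpenMap f :=
    ContinuousLinearMap.isOpenMap (⟨f.toLinearMap, hf₁⟩ : B →L[ℂ] A) hfs
  refine ⟨X, inferInstance, inferInstance, inferInstance, B, RingHom.ker f,
    Ideal.quotientKerAlgEquivOfSurjective hfs, ⟨S.isClosed_topologicalClosure, ?_⟩, ?_, ?_, ?_⟩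
  · intro x y hxy
    obtain ⟨i, hi⟩ := Function.ne_iff.1 hxy
    refine ⟨polydiscCoord ι i, ⟨polydiscCoord ι i, S.le_topologicalClosure
      ⟨MvPolynomial.X i, by simp [polydiscEval]⟩, rfl⟩, fun h => hi (Subtype.ext h)⟩
  · exact isClosed_singleton.preimage hf₁
  · exact hf₁.quotient_lift _
  · refine continuous_def.2 fun U hU => ?_
    have : (Ideal.quotientKerAlgEquivOfSurjective hfs).symm ⁻¹' U
        = f '' (Ideal.Quotient.mk (RingHom.ker f) ⁻¹' U) := by
      ext a
      constructor
      · intro ha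
        obtain ⟨b, rfl⟩ := hfs a
        refine ⟨b, ?_, rfl⟩
        rwa [Set.mem_preimage, Ideal.quotientKerAlgEquivOfSurjective_symm_apply] at ha
      · rintro ⟨b, hb, rfl⟩
        rwa [Set.mem_preimage, Ideal.quotientKerAlgEquivOfSurjective_symm_apply]
    rw [this]
    exact hopen _ (hU.preimage continuous_quot_mk)

theorem IsInjectiveAlgebra.isIsomorphicToQAlgebra {κ : ℝ} (hA : IsInjectiveAlgebra A κ)
    (hκ : 0 ≤ κ) : IsIsomorphicToQAlgebra A :=
  isIsomorphicToQAlgebra_of_norm_aeval_le (δ := (1 + Real.exp 1 * κ)⁻¹) (by positivity)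
    fun _ a ha P _ hP hR => hA.norm_aeval_le (by positivity) hκ
      (inv_mul_cancel₀ (by positivity)).le a ha P hP hR

end QAlgebra

/-! ### Completeness -/

namespace WeightedL1

variable {G : Type u} [Group G] {w : Weight G}

/-- The isometry `f ↦ f w` onto the unweighted space. -/
def toLp (f : WeightedL1 w) : lp (fun _ : G => ℂ) 1 :=
  ⟨fun x => f x * w x, memℓp_gen (by
    simpa [abs_of_pos (w.pos _)] using f.summable)⟩

theorem toLp_apply (f : WeightedL1 w) (x : G) : toLp f x = f x * w x := rfl

theorem norm_toLp (f : WeightedL1 w) : ‖toLp f‖ = ‖f‖ := by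
  rw [lp.norm_eq_tsum_rpow (by simp), norm_def]
  simp [toLp_apply, abs_of_pos (w.pos _)]

theorem isometry_toLp : Isometry (toLp : WeightedL1 w → lp (fun _ : G => ℂ) 1) := by
  refine Isometry.of_dist_eq fun f g => ?_
  rw [dist_eq_norm, dist_eq_norm, ← norm_toLp]
  congr 1
  ext x
  have : (f - g) x = f x - g x := rfl
  simp [toLp_apply, this, sub_mul]

theorem surjective_toLp :
    Function.Surjective (toLp : WeightedL1 w → lp (fun _ : G => ℂ) 1) := by
  intro g
  have hw : ∀ x, (w x : ℂ) ≠ 0 := fun x => Complex.ofReal_ne_zero.2 (w.pos x).ne'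
  refine ⟨⟨fun x => g x / w x, ?_⟩, ?_⟩
  · have h := (lp.memℓp g).summable (by simp)
    show Summable fun x => ‖g x / w x‖ * w x
    refine h.congr fun x => ?_
    simp [abs_of_pos (w.pos x), div_mul_cancel₀ _ (w.pos x).ne']
  · ext x
    exact div_mul_cancel₀ _ (hw x)

instance : CompleteSpace (WeightedL1 w) :=
  (isometry_toLp.isUniformInducing.completeSpace_congr surjective_toLp).2 inferInstance

end WeightedL1

instance centerCompleteSpace (A : Type u) [NormedRing A] [NormedAlgebra ℂ A] [CompleteSpace A] :
    CompleteSpace (Subalgebra.center ℂ A) := by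
  have : IsClosed (Subalgebra.center ℂ A : Set A) := by
    have h : (Subalgebra.center ℂ A : Set A) = Set.centralizer Set.univ := by
      rw [Set.centralizer_univ]; rfl
    rw [h]
    exact Set.isClosed_centralizer _
  exact this.completeSpace_coe

theorem IsInjectiveAlgebra.center {A : Type u} [NormedRing A] [NormedAlgebra ℂ A] {κ : ℝ}
    (hA : IsInjectiveAlgebra A κ) : IsInjectiveAlgebra (Subalgebra.center ℂ A) κ := by
  intro n c a δ R hδ ha hc
  have hnorm : ∀ x : Subalgebra.center ℂ A, ‖x‖ = ‖(x : A)‖ := fun _ => rfl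
  have h := hA n (fun j => c j) (fun j => a j) δ R hδ ha fun t ht => by
    have := hc t ht
    rw [hnorm] at this
    simpa using this
  rw [hnorm]
  simpa using h

/-! ### Weighted matrix inequalities -/

/-- `∑ |a x y| Ω x y ≤ κ` whenever the bilinear form of the finite matrix `a` is bounded by `1` on
the unit balls for the supremum norm. -/
def MatrixBound {ι : Type*} (Ω : ι → ι → ℝ) (κ : ℝ) : Prop :=
  ∀ (S T : Finset ι) (a : ι → ι → ℂ) (R : ℝ),
    (∀ s t : ι → ℂ, (∀ x, ‖s x‖ ≤ 1) → (∀ y, ‖t y‖ ≤ 1) →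
      ‖∑ x ∈ S, ∑ y ∈ T, a x y * s x * t y‖ ≤ R) →
    ∑ x ∈ S, ∑ y ∈ T, ‖a x y‖ * Ω x y ≤ κ * R

namespace WeightedL1

variable {G : Type u} [Group G] {w : Weight G}

theorem sum_apply {n : ℕ} (f : Fin n → WeightedL1 w) (x : G) :
    (∑ j, f j) x = ∑ j, f j x := by
  have h : ∀ s : Finset (Fin n), (∑ j ∈ s, f j) x = ∑ j ∈ s, f j x := by
    classical
    intro s
    induction s using Finset.induction_on with
    | empty => simp
    | insert i s hi ih => rw [Finset.sum_insert hi, Finset.sum_insert hi, add_apply, ih]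
  exact h _

/-- The matrix of a tensor in `ℓ¹ ⊗ ℓ¹`. -/
def tensorKernel {n : ℕ} (c a : Fin n → WeightedL1 w) (x y : G) : ℂ := ∑ j, c j x * a j y

/-- Pairing the second leg with t gives scalars τ_j of modulus at most δ. Hence the kernel
multiplied by w(x)w(y) is a bilinear form of norm at most δR on the sup-norm balls, by the
hypothesis on ∑ t_j c_j. -/
theorem sum_tensorKernel_le {Ω : G → G → ℝ} {κ : ℝ} (hΩ : MatrixBound Ω κ)
    (hw : ∀ x y, w (x * y) ≤ Ω x y * (w x * w y)) {n : ℕ} {c a : Fin n → WeightedL1 w}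
    {δ R : ℝ} (hδ : 0 < δ) (ha : ∀ j, ‖a j‖ ≤ δ)
    (hc : ∀ t : Fin n → ℂ, (∀ j, ‖t j‖ ≤ 1) → ‖∑ j, t j • c j‖ ≤ R) (S T : Finset G) :
    ∑ x ∈ S, ∑ y ∈ T, ‖tensorKernel c a x y‖ * w (x * y) ≤ κ * δ * R := by
  have key := hΩ S T (fun x y => tensorKernel c a x y * (w x * w y)) (δ * R) ?_
  · rw [mul_assoc]
    refine le_trans (Finset.sum_le_sum fun x _ => Finset.sum_le_sum fun y _ => ?_) key
    have : ‖tensorKernel c a x y * ((w x : ℂ) * w y)‖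
        = ‖tensorKernel c a x y‖ * (w x * w y) := by
      simp [abs_of_pos (w.pos _)]
    rw [this, mul_assoc, mul_comm (w x * w y)]
    exact mul_le_mul_of_nonneg_left (hw x y) (norm_nonneg _)
  · intro s t hs ht
    set τ : Fin n → ℂ := fun j => ∑ y ∈ T, a j y * w y * t y with hτ
    have hτδ : ∀ j, ‖τ j‖ ≤ δ := fun j => by
      refine le_trans ?_ (ha j)
      rw [norm_def]
      refine le_trans (norm_sum_le _ _) (le_trans (Finset.sum_le_sum fun y _ => ?_)
        ((a j).summable.sum_le_tsum T fun y _ => (a j).term_nonneg y))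
      rw [norm_mul, norm_mul, Complex.norm_real, Real.norm_of_nonneg (w.pos y).le]
      exact mul_le_of_le_one_right ((a j).term_nonneg y) (ht y)
    have h1 : ‖∑ j, (((δ⁻¹ : ℝ) : ℂ) * τ j) • c j‖ ≤ R := by
      refine hc _ fun j => ?_
      rw [norm_mul, Complex.norm_real, Real.norm_of_nonneg (by positivity), inv_mul_le_iff₀ hδ,
        mul_one]
      exact hτδ j
    have h2 : ∑ j, τ j • c j = (δ : ℂ) • ∑ j, (((δ⁻¹ : ℝ) : ℂ) * τ j) • c j := by
      rw [Finset.smul_sum]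
      refine Finset.sum_congr rfl fun j _ => ?_
      rw [smul_smul, ← mul_assoc, ← Complex.ofReal_mul, mul_inv_cancel₀ hδ.ne', Complex.ofReal_one,
        one_mul]
    have h3 : ‖∑ j, τ j • c j‖ ≤ δ * R := by
      rw [h2, norm_smul, Complex.norm_real, Real.norm_of_nonneg hδ.le]
      exact mul_le_mul_of_nonneg_left h1 hδ.le
    have h4 : ∑ x ∈ S, ∑ y ∈ T, tensorKernel c a x y * (w x * w y) * s x * t y
        = ∑ x ∈ S, (∑ j, τ j • c j) x * w x * s x := by
      refine Finset.sum_congr rfl fun x _ => ?_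
      simp only [sum_apply, smul_apply, tensorKernel, hτ, Finset.sum_mul]
      rw [Finset.sum_comm]
      refine Finset.sum_congr rfl fun j _ => Finset.sum_congr rfl fun y _ => ?_
      ring
    rw [h4]
    refine le_trans ?_ h3
    rw [norm_def]
    refine le_trans (norm_sum_le _ _) (le_trans (Finset.sum_le_sum fun x _ => ?_)
      ((∑ j, τ j • c j).summable.sum_le_tsum S fun x _ => (∑ j, τ j • c j).term_nonneg x))
    rw [norm_mul, norm_mul, Complex.norm_real, Real.norm_of_nonneg (w.pos x).le]
    exact mul_le_of_le_one_right ((∑ j, τ j • c j).term_nonneg x) (hs x)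

/-- The product ∑ c_j * a_j is the push-forward of the tensor kernel along (x, y) ↦ xy, so its norm
is at most the kernel's sum weighted by w(xy). -/
theorem isInjectiveAlgebra_of_matrixBound {Ω : G → G → ℝ} {κ : ℝ} (hκ : 0 ≤ κ)
    (hΩ : MatrixBound Ω κ) (hw : ∀ x y, w (x * y) ≤ Ω x y * (w x * w y)) :
    IsInjectiveAlgebra (WeightedL1 w) κ := by
  classical
  intro n c a δ R hδ' ha hc
  have hR0 : 0 ≤ R := (norm_nonneg _).trans (hc 0 (by simp))
  by_cases hδ : 0 < δ
  swap
  · have ha0 : ∀ j, a j = 0 := fun j => norm_le_zero_iff.1 ((ha j).trans (not_lt.1 hδ))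
    simp only [ha0, mul_zero, Finset.sum_const_zero, norm_zero]
    positivity
  have hb : ∀ U : Finset (G × G), ∑ p ∈ U, ‖tensorKernel c a p.1 p.2‖ * w (p.1 * p.2)
      ≤ κ * δ * R := by
    intro U
    refine le_trans ?_ (sum_tensorKernel_le hΩ hw hδ ha hc (U.image Prod.fst) (U.image Prod.snd))
    rw [← Finset.sum_product']
    refine Finset.sum_le_sum_of_subset_of_nonneg Finset.subset_product fun p _ _ =>
      mul_nonneg (norm_nonneg _) (w.pos _).le
  have hnn : ∀ p : G × G, 0 ≤ ‖tensorKernel c a p.1 p.2‖ * w (p.1 * p.2) :=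
    fun p => mul_nonneg (norm_nonneg _) (w.pos _).le
  have hsum : Summable fun p : G × G => ‖tensorKernel c a p.1 p.2‖ * w (p.1 * p.2) :=
    summable_of_sum_le hnn hb
  -- The substitution (z, y) ↦ (y, y⁻¹z) reindexes pairs by their product z.
  let e : G × G ≃ G × G :=
    (Equiv.prodComm G G).trans (Equiv.prodShear (Equiv.refl G) fun y => Equiv.mulLeft y⁻¹)
  have he : ∀ p : G × G, ‖tensorKernel c a (e p).1 (e p).2‖ * w ((e p).1 * (e p).2)
      = ‖tensorKernel c a p.2 (p.2⁻¹ * p.1)‖ * w p.1 := by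
    intro p
    simp [e]
  have hsum' : Summable fun p : G × G => ‖tensorKernel c a p.2 (p.2⁻¹ * p.1)‖ * w p.1 :=
    (e.summable_iff.2 hsum).congr he
  have hF : ∀ z, (∑ j, c j * a j) z = ∑' y, tensorKernel c a y (y⁻¹ * z) := by
    intro z
    rw [sum_apply]
    simp only [mul_apply, tensorKernel]
    rw [Summable.tsum_finsetSum fun j _ => summable_conv (c j) (a j) z]
  calc ‖∑ j, c j * a j‖ ≤ ∑' z, ∑' y, ‖tensorKernel c a y (y⁻¹ * z)‖ * w z := by
        refine (∑ j, c j * a j).summable.tsum_le_tsum (fun z => ?_) hsum'.prod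
        rw [hF, tsum_mul_right]
        refine mul_le_mul_of_nonneg_right (norm_tsum_le_tsum_norm ?_) (w.pos z).le
        exact (summable_mul_right_iff (w.pos z).ne').1 (hsum'.prod_factor z)
    _ = ∑' p : G × G, ‖tensorKernel c a p.2 (p.2⁻¹ * p.1)‖ * w p.1 := hsum'.tsum_prod.symm
    _ = ∑' p : G × G, ‖tensorKernel c a p.1 p.2‖ * w (p.1 * p.2) := by
        rw [← e.tsum_eq fun p : G × G => ‖tensorKernel c a p.1 p.2‖ * w (p.1 * p.2)]
        exact tsum_congr fun p => (he p).symm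
    _ ≤ κ * δ * R := hsum.tsum_le_of_sum_le hb

end WeightedL1

/-! ### Calculus of matrix bounds -/

namespace MatrixBound

variable {ι : Type*} {Ω Ω' : ι → ι → ℝ} {κ κ' : ℝ}

theorem mono (h : MatrixBound Ω' κ) (hΩ : ∀ x y, Ω x y ≤ Ω' x y) : MatrixBound Ω κ :=
  fun S T a R hR => le_trans (Finset.sum_le_sum fun x _ => Finset.sum_le_sum fun y _ =>
    mul_le_mul_of_nonneg_left (hΩ x y) (norm_nonneg _)) (h S T a R hR)

theorem mono_right (h : MatrixBound Ω κ) (hκ : κ ≤ κ') : MatrixBound Ω κ' :=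
  fun S T a R hR => (h S T a R hR).trans (mul_le_mul_of_nonneg_right hκ
    ((norm_nonneg _).trans (hR 0 0 (by simp) (by simp))))

theorem add (h : MatrixBound Ω κ) (h' : MatrixBound Ω' κ') :
    MatrixBound (fun x y => Ω x y + Ω' x y) (κ + κ') := by
  intro S T a R hR
  simp only [mul_add, Finset.sum_add_distrib, add_mul]
  exact add_le_add (h S T a R hR) (h' S T a R hR)

theorem const_mul (h : MatrixBound Ω κ) {c : ℝ} (hc : 0 ≤ c) :
    MatrixBound (fun x y => c * Ω x y) (c * κ) := by
  intro S T a R hR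
  simp only [mul_left_comm _ c, ← Finset.mul_sum, mul_assoc c]
  exact mul_le_mul_of_nonneg_left (h S T a R hR) hc

theorem swap (h : MatrixBound Ω κ) : MatrixBound (fun x y => Ω y x) κ := by
  intro S T a R hR
  rw [Finset.sum_comm]
  refine h T S (fun x y => a y x) R fun s t hs ht => ?_
  rw [Finset.sum_comm]
  simpa only [mul_right_comm] using hR t s ht hs

/-- This trades a bound proportional to the Grothendieck constant against an absolute one for the
same weight. -/
theorem convexComb (h : MatrixBound Ω κ) (h' : MatrixBound Ω κ') {p q : ℝ} (hp : 0 ≤ p)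
    (hq : 0 ≤ q) (hpq : p + q = 1) : MatrixBound Ω (p * κ + q * κ') :=
  ((h.const_mul hp).add (h'.const_mul hq)).mono fun x y => by
    rw [← add_mul, hpq, one_mul]

/-- The weights `v x`, with `v` summable. -/
theorem of_summable {v : ι → ℝ} (hv0 : ∀ x, 0 ≤ v x) (hv : Summable v) :
    MatrixBound (fun x _ => v x) (∑' x, v x) := by
  classical
  intro S T a R hR
  have hR0 : 0 ≤ R := (norm_nonneg _).trans (hR 0 0 (by simp) (by simp))
  have hrow : ∀ x ∈ S, ∑ y ∈ T, ‖a x y‖ ≤ R := by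
    intro x hx
    choose t ht1 ht2 using fun y => exists_unimodular_mul_eq_norm (a x y)
    -- Testing on a single row, with the phases of its entries, bounds its absolute sum by R.
    have h := hR (Pi.single x 1) t (fun x' => by
      by_cases h : x' = x
      · subst h; simp
      · simp [h]) ht1
    rw [Finset.sum_eq_single x (fun x' _ hne => by simp [hne]) (fun h => absurd hx h)] at h
    have h2 : ∑ y ∈ T, a x y * (Pi.single x 1 : ι → ℂ) x * t y
        = ((∑ y ∈ T, ‖a x y‖ : ℝ) : ℂ) := by
      rw [Complex.ofReal_sum]
      refine Finset.sum_congr rfl fun y _ => ?_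
      rw [Pi.single_eq_same, mul_one, mul_comm, ht2]
    rwa [h2, Complex.norm_real,
      Real.norm_of_nonneg (Finset.sum_nonneg fun _ _ => norm_nonneg _)] at h
  calc ∑ x ∈ S, ∑ y ∈ T, ‖a x y‖ * v x ≤ ∑ x ∈ S, v x * R :=
        Finset.sum_le_sum fun x hx => by
          rw [← Finset.sum_mul, mul_comm]
          exact mul_le_mul_of_nonneg_left (hrow x hx) (hv0 x)
    _ = (∑ x ∈ S, v x) * R := (Finset.sum_mul _ _ _).symm
    _ ≤ (∑' x, v x) * R :=
        mul_le_mul_of_nonneg_right (hv.sum_le_tsum S fun x _ => hv0 x) hR0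

end MatrixBound

/-! ### Matrix bounds from the Grothendieck constant -/

theorem one_le_grothendieckConstant : 1 ≤ grothendieckConstant := by
  refine le_sInf fun K hK => ?_
  have h := hK 1 1 (fun _ _ => 1) (fun s t hs ht => by
    simpa using mul_le_one₀ (hs 0) (norm_nonneg _) (ht 0)) ℂ (fun _ => 1) (fun _ => 1)
    (by simp) (by simp)
  simpa using h

theorem norm_sum_inner_le_one (hK : grothendieckConstant ≠ ⊤) {m n : ℕ}
    (a : Matrix (Fin m) (Fin n) ℂ)
    (ha : ∀ (s : Fin m → ℂ) (t : Fin n → ℂ), (∀ i, ‖s i‖ ≤ 1) → (∀ j, ‖t j‖ ≤ 1) →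
      ‖∑ i, ∑ j, a i j * s i * t j‖ ≤ 1)
    {H : Type} [NormedAddCommGroup H] [InnerProductSpace ℂ H] [CompleteSpace H]
    (x : Fin m → H) (y : Fin n → H) (hx : ∀ i, ‖x i‖ ≤ 1) (hy : ∀ j, ‖y j‖ ≤ 1) :
    ‖∑ i, ∑ j, a i j * inner ℂ (x i) (y j)‖ ≤ grothendieckConstant.toReal := by
  refine (ENNReal.ofReal_le_iff_le_toReal hK).1 ?_
  exact le_sInf fun K h => h m n a ha H x y hx hy

theorem Finset.sum_equivFin_symm {ι M : Type*} [AddCommMonoid M] (S : Finset ι) (f : ι → M) :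
    ∑ i, f (S.equivFin.symm i) = ∑ x ∈ S, f x := by
  rw [S.equivFin.symm.sum_comp fun x : S => f x, Finset.sum_coe_sort]

/-- The definition of the constant is rescaled in the matrix and in the vectors, and carried from
index types `Fin n` to finite sets. -/
theorem norm_sum_inner_le (hK : grothendieckConstant ≠ ⊤) {ι : Type*} (S T : Finset ι)
    (a : ι → ι → ℂ) {R : ℝ}
    (hR : ∀ s t : ι → ℂ, (∀ x, ‖s x‖ ≤ 1) → (∀ y, ‖t y‖ ≤ 1) →
      ‖∑ x ∈ S, ∑ y ∈ T, a x y * s x * t y‖ ≤ R)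
    {H : Type} [NormedAddCommGroup H] [InnerProductSpace ℂ H] [CompleteSpace H]
    (ξ η : ι → H) {X Y : ℝ} (hX : 0 < X) (hY : 0 < Y)
    (hξ : ∀ x, ‖ξ x‖ ≤ X) (hη : ∀ y, ‖η y‖ ≤ Y) :
    ‖∑ x ∈ S, ∑ y ∈ T, a x y * inner ℂ (ξ x) (η y)‖
      ≤ grothendieckConstant.toReal * (X * Y) * R := by
  classical
  have hR0 : 0 ≤ R := (norm_nonneg _).trans (hR 0 0 (by simp) (by simp))
  -- R may be 0, so the matrix is divided by a larger R', which then tends to R.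
  have hmain : ∀ R' : ℝ, R < R' → ‖∑ x ∈ S, ∑ y ∈ T, a x y * inner ℂ (ξ x) (η y)‖
      ≤ grothendieckConstant.toReal * (X * Y) * R' := by
    intro R' hR'
    have hR'0 : 0 < R' := hR0.trans_lt hR'
    have h := norm_sum_inner_le_one hK
      (fun i j => ((R'⁻¹ : ℝ) : ℂ) * a (S.equivFin.symm i) (T.equivFin.symm j)) ?_
      (fun i => ((X⁻¹ : ℝ) : ℂ) • ξ (S.equivFin.symm i))
      (fun j => ((Y⁻¹ : ℝ) : ℂ) • η (T.equivFin.symm j)) ?_ ?_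
    · have h2 : ∑ i, ∑ j, ((R'⁻¹ : ℝ) : ℂ) * a (S.equivFin.symm i) (T.equivFin.symm j) *
          inner ℂ (((X⁻¹ : ℝ) : ℂ) • ξ (S.equivFin.symm i))
            (((Y⁻¹ : ℝ) : ℂ) • η (T.equivFin.symm j))
          = ((R'⁻¹ * X⁻¹ * Y⁻¹ : ℝ) : ℂ) *
            ∑ x ∈ S, ∑ y ∈ T, a x y * inner ℂ (ξ x) (η y) := by
        rw [← Finset.sum_equivFin_symm S, Finset.mul_sum]
        refine Finset.sum_congr rfl fun i _ => ?_
        rw [← Finset.sum_equivFin_symm T, Finset.mul_sum]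
        refine Finset.sum_congr rfl fun j _ => ?_
        rw [inner_smul_left, inner_smul_right, Complex.conj_ofReal]
        push_cast
        ring
      rw [h2, norm_mul, Complex.norm_real, Real.norm_of_nonneg (by positivity)] at h
      calc ‖∑ x ∈ S, ∑ y ∈ T, a x y * inner ℂ (ξ x) (η y)‖
          = (X * Y * R') * (R'⁻¹ * X⁻¹ * Y⁻¹ *
            ‖∑ x ∈ S, ∑ y ∈ T, a x y * inner ℂ (ξ x) (η y)‖) := by field_simp
        _ ≤ (X * Y * R') * grothendieckConstant.toReal :=
            mul_le_mul_of_nonneg_left h (by positivity)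
        _ = _ := by ring
    · intro s t hs ht
      have h1 := hR (fun x => if hx : x ∈ S then s (S.equivFin ⟨x, hx⟩) else 0)
        (fun y => if hy : y ∈ T then t (T.equivFin ⟨y, hy⟩) else 0)
        (fun x => by split_ifs <;> simp [hs])
        (fun y => by split_ifs <;> simp [ht])
      have h2 : ∑ i, ∑ j, ((R'⁻¹ : ℝ) : ℂ) * a (S.equivFin.symm i) (T.equivFin.symm j) * s i * t j
          = ((R'⁻¹ : ℝ) : ℂ) * ∑ x ∈ S, ∑ y ∈ T, a x y *
            (if hx : x ∈ S then s (S.equivFin ⟨x, hx⟩) else 0) *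
            (if hy : y ∈ T then t (T.equivFin ⟨y, hy⟩) else 0) := by
        rw [← Finset.sum_equivFin_symm S, Finset.mul_sum]
        refine Finset.sum_congr rfl fun i _ => ?_
        rw [← Finset.sum_equivFin_symm T, Finset.mul_sum]
        refine Finset.sum_congr rfl fun j _ => ?_
        simp
        ring
      rw [h2, norm_mul, Complex.norm_real, Real.norm_of_nonneg (by positivity),
        inv_mul_le_iff₀ hR'0, mul_one]
      exact h1.trans hR'.le
    · intro i
      rw [norm_smul, Complex.norm_real, Real.norm_of_nonneg (by positivity), inv_mul_le_iff₀ hX,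
        mul_one]
      exact hξ _
    · intro j
      rw [norm_smul, Complex.norm_real, Real.norm_of_nonneg (by positivity), inv_mul_le_iff₀ hY,
        mul_one]
      exact hη _
  have hlim : Filter.Tendsto (fun R' => grothendieckConstant.toReal * (X * Y) * R')
      (nhdsWithin R (Set.Ioi R)) (nhds (grothendieckConstant.toReal * (X * Y) * R)) :=
    (Continuous.tendsto (by fun_prop) R).mono_left nhdsWithin_le_nhds
  exact ge_of_tendsto hlim (Filter.eventually_of_mem self_mem_nhdsWithin hmain)

/-- A weight all of whose modulations are Gram matrices of bounded vectors. -/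
theorem MatrixBound.of_inner (hK : grothendieckConstant ≠ ⊤) {ι : Type*} {Ω : ι → ι → ℝ}
    {X Y : ℝ} (hX : 0 < X) (hY : 0 < Y)
    (h : ∀ (S T : Finset ι) (θ : ι → ι → ℂ), (∀ x y, ‖θ x y‖ ≤ 1) →
      ∃ (m : ℕ) (ξ η : ι → EuclideanSpace ℂ (Fin m)), (∀ x, ‖ξ x‖ ≤ X) ∧ (∀ y, ‖η y‖ ≤ Y) ∧
        ∀ x ∈ S, ∀ y ∈ T, inner ℂ (ξ x) (η y) = θ x y * Ω x y) :
    MatrixBound Ω (grothendieckConstant.toReal * (X * Y)) := by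
  intro S T a R hR
  -- Absorbing the phases of a into the Gram matrix turns the sum of a(x,y)⟨ξ_x, η_y⟩ into the sum
  -- of |a(x,y)| Ω(x,y).
  choose θ hθ1 hθ2 using fun x y => exists_unimodular_mul_eq_norm (a x y)
  obtain ⟨m, ξ, η, hξ, hη, hΩ⟩ := h S T θ hθ1
  have key := norm_sum_inner_le hK S T a hR ξ η hX hY hξ hη
  have h2 : ∑ x ∈ S, ∑ y ∈ T, a x y * inner ℂ (ξ x) (η y)
      = ((∑ x ∈ S, ∑ y ∈ T, ‖a x y‖ * Ω x y : ℝ) : ℂ) := by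
    push_cast
    refine Finset.sum_congr rfl fun x hx => Finset.sum_congr rfl fun y hy => ?_
    rw [hΩ x hx y hy, ← hθ2]
    ring
  rw [h2, Complex.norm_real] at key
  exact (le_abs_self _).trans key

/-- The weights `v x`, with `v` square summable. -/
theorem MatrixBound.of_sum_sq_le (hK : grothendieckConstant ≠ ⊤) {ι : Type*} {v : ι → ℝ} {N : ℝ}
    (hN : 0 < N) (hv : ∀ S : Finset ι, ∑ x ∈ S, v x ^ 2 ≤ N ^ 2) :
    MatrixBound (fun x _ => v x) (grothendieckConstant.toReal * N) := by
  classical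
  have := MatrixBound.of_inner hK (Ω := fun x _ => v x) one_pos hN ?_
  · rwa [one_mul] at this
  intro S T θ hθ
  -- ξ_x is a basis vector, and η_y carries all the entries θ(x,y)v(x); |θ| ≤ 1 leaves its norm at
  -- most N.
  refine ⟨S.card, fun x => if hx : x ∈ S then EuclideanSpace.single (S.equivFin ⟨x, hx⟩) 1 else 0,
    fun y => WithLp.toLp 2 fun i => θ (S.equivFin.symm i) y * v (S.equivFin.symm i),
    fun x => ?_, fun y => ?_, fun x hx y _ => ?_⟩
  · dsimp only
    split_ifs <;> simp
  · refine (sq_le_sq₀ (norm_nonneg _) hN.le).1 ?_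
    rw [EuclideanSpace.norm_sq_eq]
    refine le_trans ?_ (hv S)
    rw [← Finset.sum_equivFin_symm S]
    refine Finset.sum_le_sum fun i _ => ?_
    simp only [norm_mul, Complex.norm_real, mul_pow, Real.norm_eq_abs, sq_abs]
    exact mul_le_of_le_one_left (sq_nonneg _) (pow_le_one₀ (norm_nonneg _) (hθ _ _))
  · simp [hx, EuclideanSpace.inner_single_left]

open Classical in
/-- The weight supported on the row and the column through `e`. -/
theorem MatrixBound.cross {ι : Type*} (e : ι) :
    MatrixBound (fun x y => if x = e ∨ y = e then 1 else 0) 2 := by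
  have h1 : MatrixBound (fun x _ : ι => if x = e then (1 : ℝ) else 0) 1 := by
    have := MatrixBound.of_summable (v := fun x : ι => if x = e then (1 : ℝ) else 0)
      (fun x => by split_ifs <;> simp)
      (summable_of_ne_finset_zero (s := {e}) fun x hx => if_neg (by simpa using hx))
    rwa [tsum_ite_eq] at this
  have h2 := (h1.add h1.swap).mono (Ω := fun x y => if x = e ∨ y = e then 1 else 0) fun x y => by
    by_cases hx : x = e <;> by_cases hy : y = e <;> simp [hx, hy]
  norm_num at h2
  exact h2

open Classical in
-- In ℂ² one coordinate produces the column through e and the other the row. The corner entry is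
-- shared equally between them, so every vector has squared norm at most 1 + 1/4.
theorem MatrixBound.cross_grothendieck (hK : grothendieckConstant ≠ ⊤) {ι : Type*} (e : ι) :
    MatrixBound (fun x y => if x = e ∨ y = e then 1 else 0)
      (grothendieckConstant.toReal * (5 / 4)) := by
  have h54 : Real.sqrt (5 / 4) * Real.sqrt (5 / 4) = 5 / 4 :=
    Real.mul_self_sqrt (by norm_num)
  have hpos : 0 < Real.sqrt (5 / 4) := Real.sqrt_pos.2 (by norm_num)
  rw [← h54]
  refine MatrixBound.of_inner hK hpos hpos fun S T θ hθ => ⟨2,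
    fun x => if x = e then !₂[(starRingEnd ℂ) (θ e e) / 2, 1] else !₂[(starRingEnd ℂ) (θ x e), 0],
    fun y => if y = e then !₂[1, θ e e / 2] else !₂[0, θ e y],
    fun x => ?_, fun y => ?_, fun x _ y _ => ?_⟩
  · rw [EuclideanSpace.norm_eq]
    refine Real.sqrt_le_sqrt ?_
    have h1 := pow_le_one₀ (n := 2) (norm_nonneg _) (hθ e e)
    have h2 := pow_le_one₀ (n := 2) (norm_nonneg _) (hθ x e)
    dsimp only
    split_ifs <;> simp [Fin.sum_univ_two, div_pow] <;> linarith
  · rw [EuclideanSpace.norm_eq]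
    refine Real.sqrt_le_sqrt ?_
    have h1 := pow_le_one₀ (n := 2) (norm_nonneg _) (hθ e e)
    have h2 := pow_le_one₀ (n := 2) (norm_nonneg _) (hθ e y)
    dsimp only
    split_ifs <;> simp [Fin.sum_univ_two, div_pow] <;> linarith
  · by_cases hx : x = e <;> by_cases hy : y = e <;>
      simp [hx, hy, PiLp.inner_apply, Fin.sum_univ_two, map_ofNat]

/-! ### Exponential weights -/

/-- Bernoulli's inequality gives (1+u)^α ≤ 1 + αu for u = s/r, and u ≤ u^α because u ≤ 1. -/
theorem add_rpow_le_add_mul_rpow {α s r : ℝ} (hα0 : 0 < α) (hα1 : α < 1) (hs : 0 ≤ s)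
    (hsr : s ≤ r) : (s + r) ^ α ≤ r ^ α + α * s ^ α := by
  rcases hs.eq_or_lt with rfl | hs0
  · simp [Real.zero_rpow hα0.ne']
  have hr0 : 0 < r := hs0.trans_le hsr
  have h1 : (1 + s / r) ^ α ≤ 1 + α * (s / r) :=
    rpow_one_add_le_one_add_mul_self (by have := div_nonneg hs hr0.le; linarith) hα0.le hα1.le
  have h2 : s + r = r * (1 + s / r) := by field_simp; ring
  have h3 : s / r ≤ (s / r) ^ α := by
    simpa using Real.rpow_le_rpow_of_exponent_ge (div_pos hs0 hr0) ((div_le_one hr0).2 hsr) hα1.le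
  rw [h2, Real.mul_rpow hr0.le (by positivity)]
  calc r ^ α * (1 + s / r) ^ α ≤ r ^ α * (1 + α * (s / r) ^ α) := by
        refine mul_le_mul_of_nonneg_left (h1.trans ?_) (by positivity)
        have := mul_le_mul_of_nonneg_left h3 hα0.le
        linarith
    _ = r ^ α + α * s ^ α := by
        rw [Real.div_rpow hs hr0.le]
        have := (Real.rpow_pos_of_pos hr0 α).ne'
        field_simp

/-- The decay of the submultiplicativity defect of the weight `exp (C n ^ α)`. -/
def expDecay (α C : ℝ) (n : ℕ) : ℝ := Real.exp (-(C * (1 - α) * (n : ℝ) ^ α))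

theorem expDecay_pos (α C : ℝ) (n : ℕ) : 0 < expDecay α C n := Real.exp_pos _

theorem expDecay_le_one {α C : ℝ} (hα1 : α < 1) (hC : 0 < C) (n : ℕ) : expDecay α C n ≤ 1 := by
  rw [expDecay, Real.exp_le_one_iff, neg_nonpos]
  have : 0 < 1 - α := by linarith
  positivity

/-- The smaller length enters (s+r)^α with coefficient only α, whereas the product of weights has
coefficient 1; the difference 1 - α is the gain. -/
theorem exp_add_le_expDecay {α C : ℝ} (hα0 : 0 < α) (hα1 : α < 1) (hC : 0 < C) {t s r : ℕ}
    (ht : t ≤ s + r) (hsr : s ≤ r) :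
    Real.exp (C * (t : ℝ) ^ α) ≤
      expDecay α C s * (Real.exp (C * (s : ℝ) ^ α) * Real.exp (C * (r : ℝ) ^ α)) := by
  rw [expDecay, ← Real.exp_add, ← Real.exp_add, Real.exp_le_exp]
  have h1 : (t : ℝ) ^ α ≤ ((s : ℝ) + r) ^ α :=
    Real.rpow_le_rpow (Nat.cast_nonneg _) (by exact_mod_cast ht) hα0.le
  have h2 := add_rpow_le_add_mul_rpow hα0 hα1 (Nat.cast_nonneg s) (Nat.cast_le.2 hsr : (s : ℝ) ≤ r)
  have h3 := mul_le_mul_of_nonneg_left (h1.trans h2) hC.le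
  linarith

theorem summable_polynomial_mul_expDecay {α C : ℝ} (hα0 : 0 < α) (hα1 : α < 1) (hC : 0 < C)
    (g : ℝ[X]) : Summable fun n : ℕ => g.eval (n : ℝ) * expDecay α C n := by
  have hc : 0 < C * (1 - α) := mul_pos hC (by linarith)
  -- Substituting n^α in this power gives n^(-deg g - 2), so n^(-2) remains after multiplying by
  -- g(n).
  have h1 := (isLittleO_exp_neg_mul_rpow_atTop hc (-((g.natDegree + 2 : ℕ) : ℝ) / α)).comp_tendsto
    ((tendsto_rpow_atTop hα0).comp tendsto_natCast_atTop_atTop)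
  have h2 : (fun n : ℕ => g.eval (n : ℝ)) =O[Filter.atTop] fun n : ℕ => (n : ℝ) ^ g.natDegree := by
    have := Polynomial.isBigO_atTop_of_degree_le g (Polynomial.X ^ g.natDegree) (by
      rw [Polynomial.degree_X_pow]; exact Polynomial.degree_le_natDegree)
    have := this.comp_tendsto (tendsto_natCast_atTop_atTop (R := ℝ))
    simpa [Function.comp_def] using this
  have h3 := h2.mul h1.isBigO
  refine summable_of_isBigO_nat (g := fun n : ℕ => ((n : ℝ) ^ 2)⁻¹)
    (Real.summable_nat_pow_inv.2 one_lt_two) ?_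
  refine (h3.congr' ?_ ?_)
  · refine Filter.Eventually.of_forall fun n => ?_
    simp [expDecay]
  · filter_upwards [Filter.eventually_gt_atTop 0] with n hn
    have hn' : (0 : ℝ) < n := by exact_mod_cast hn
    simp only [Function.comp_apply]
    rw [← Real.rpow_mul hn'.le, mul_div_cancel₀ _ hα0.ne', Real.rpow_neg hn'.le, Real.rpow_natCast,
      pow_add]
    field_simp

/-! ### Growth -/

namespace SymmGenSet

variable {G : Type u} [Group G] (F : SymmGenSet G)

theorem eq_one_of_length_eq_zero {x : G} (h : F.length x = 0) : x = 1 := by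
  have := F.mem_pow_length x
  simpa [h] using this

theorem finite_pow (n : ℕ) : (F.carrier ^ n).Finite := by
  induction n with
  | zero => simp
  | succ n ih => rw [pow_succ]; exact ih.mul F.finite

theorem card_filter_length_le (S : Finset G) (n : ℕ) :
    (S.filter fun x => F.length x = n).card ≤ F.growth n := by
  rw [growth, ← Set.ncard_coe_finset]
  refine Set.ncard_le_ncard (fun x hx => ?_) (F.finite_pow n)
  have h : F.length x = n := (Finset.mem_filter.1 hx).2
  exact h ▸ F.mem_pow_length x

theorem card_filter_length_succ_add_le (S : Finset G) (n : ℕ) :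
    (S.filter fun x => F.length x = n + 1).card + F.growth n ≤ F.growth (n + 1) := by
  have hsub : F.carrier ^ n ⊆ F.carrier ^ (n + 1) :=
    Set.pow_subset_pow_right F.one_mem n.le_succ
  rw [growth, growth, ← Set.ncard_coe_finset, ← Set.ncard_union_eq ?_ (Finset.finite_toSet _)
    (F.finite_pow n)]
  · refine Set.ncard_le_ncard (Set.union_subset (fun x hx => ?_) hsub) (F.finite_pow _)
    have h : F.length x = n + 1 := (Finset.mem_filter.1 hx).2
    exact h ▸ F.mem_pow_length x
  · refine Set.disjoint_left.2 fun x hx hx' => ?_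
    have h : F.length x = n + 1 := (Finset.mem_filter.1 hx).2
    have : F.length x ≤ n := Nat.sInf_le hx'
    omega

theorem sum_comp_length (S : Finset G) (φ : ℕ → ℝ) {L : ℕ} (hL : ∀ x ∈ S, F.length x < L) :
    ∑ x ∈ S, φ (F.length x)
      = ∑ n ∈ Finset.range L, ((S.filter fun x => F.length x = n).card : ℝ) * φ n := by
  rw [← Finset.sum_fiberwise_of_maps_to (t := Finset.range L) (g := F.length)
    (fun x hx => Finset.mem_range.2 (hL x hx))]
  refine Finset.sum_congr rfl fun n _ => ?_
  rw [Finset.sum_congr rfl fun x hx => by rw [(Finset.mem_filter.1 hx).2], Finset.sum_const,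
    nsmul_eq_mul]

theorem exists_length_lt (S : Finset G) : ∃ L, ∀ x ∈ S, F.length x < L :=
  ⟨S.sup F.length + 1, fun _ hx => Nat.lt_succ_of_le (Finset.le_sup hx)⟩

/-- The crude bound of each sphere by its ball suffices against the stretched exponential. -/
theorem summable_expDecay_length (hF : F.HasPolynomialGrowth) {α C : ℝ} (hα0 : 0 < α)
    (hα1 : α < 1) (hC : 0 < C) : Summable fun x => expDecay α C (F.length x) := by
  obtain ⟨g, hg⟩ := hF
  have hs := summable_polynomial_mul_expDecay hα0 hα1 hC g
  have hle : ∀ n : ℕ, (F.growth n : ℝ) * expDecay α C n ≤ g.eval (n : ℝ) * expDecay α C n :=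
    fun n => mul_le_mul_of_nonneg_right (hg n) (expDecay_pos _ _ _).le
  refine summable_of_sum_le (c := ∑' n : ℕ, g.eval (n : ℝ) * expDecay α C n)
    (fun x => (expDecay_pos _ _ _).le) fun S => ?_
  obtain ⟨L, hL⟩ := F.exists_length_lt S
  rw [F.sum_comp_length S _ hL]
  refine le_trans (Finset.sum_le_sum fun n _ => ?_) (hs.sum_le_tsum (Finset.range L)
    fun n _ => le_trans (mul_nonneg (Nat.cast_nonneg _) (expDecay_pos _ _ _).le) (hle n))
  refine le_trans ?_ (hle n)
  exact mul_le_mul_of_nonneg_right (Nat.cast_le.2 (F.card_filter_length_le S n))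
    (expDecay_pos _ _ _).le

theorem expWeight_mul_le {α C : ℝ} (hα0 : 0 < α) (hα1 : α < 1) (hC : 0 < C) (x y : G) :
    F.expWeight hα0 hα1 hC (x * y) ≤
      max (expDecay α C (F.length x)) (expDecay α C (F.length y)) *
        (F.expWeight hα0 hα1 hC x * F.expWeight hα0 hα1 hC y) := by
  have hpos := mul_pos ((F.expWeight hα0 hα1 hC).pos x) ((F.expWeight hα0 hα1 hC).pos y)
  have hxy := F.length_mul_le x y
  rcases le_total (F.length x) (F.length y) with h | h
  · exact (exp_add_le_expDecay hα0 hα1 hC hxy h).trans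
      (mul_le_mul_of_nonneg_right (le_max_left _ _) hpos.le)
  · have h1 := exp_add_le_expDecay hα0 hα1 hC (hxy.trans (add_comm _ _).le) h
    rw [mul_comm (Real.exp (C * (F.length y : ℝ) ^ α))] at h1
    exact h1.trans (mul_le_mul_of_nonneg_right (le_max_right _ _) hpos.le)

/-- The square of the `ℓ²`-norm of `(1 + length)^(-β)` off the identity is at most the growth
series. -/
theorem sum_sq_le_growthSeries {f : ℝ[X]} {lam β : ℝ}
    (hf : ∀ n : ℕ, lam * f.eval (n : ℝ) ≤ F.growth n ∧ (F.growth n : ℝ) ≤ f.eval (n : ℝ))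
    (hfin : growthSeries f lam β ≠ ⊤) (S : Finset G) (hS : ∀ x ∈ S, x ≠ 1) :
    ∑ x ∈ S, ((1 + (F.length x : ℝ)) ^ (-β)) ^ 2 ≤ (growthSeries f lam β).toReal := by
  have hS' : ∀ x ∈ S, F.length x ≠ 0 := fun x hx h => hS x hx (F.eq_one_of_length_eq_zero h)
  obtain ⟨L, hL⟩ := F.exists_length_lt S
  rw [F.sum_comp_length S (fun n => ((1 + (n : ℝ)) ^ (-β)) ^ 2)
    (fun x hx => (hL x hx).trans L.lt_succ_self), Finset.sum_range_succ']
  -- Only the identity has length 0, so the sum starts at length 1, matching the shifted index of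
  -- `growthSeries`.
  have h0 : (S.filter fun x => F.length x = 0) = ∅ :=
    Finset.filter_eq_empty_iff.2 fun x hx => hS' x hx
  rw [h0, Finset.card_empty, Nat.cast_zero, zero_mul, add_zero,
    ← ENNReal.ofReal_le_iff_le_toReal hfin, ENNReal.ofReal_sum_of_nonneg (fun n _ => by positivity)]
  refine le_trans (Finset.sum_le_sum fun n _ => ENNReal.ofReal_le_ofReal ?_)
    (ENNReal.sum_le_tsum (Finset.range L))
  have hpos : (0 : ℝ) < 1 + ((n : ℝ) + 1) := by positivity
  have h1 : ((1 + ((n + 1 : ℕ) : ℝ)) ^ (-β)) ^ 2 = ((1 + ((n : ℝ) + 1)) ^ (2 * β))⁻¹ := by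
    push_cast
    rw [← Real.rpow_natCast, ← Real.rpow_mul hpos.le, ← Real.rpow_neg hpos.le]
    congr 1; push_cast; ring
  rw [h1, div_eq_mul_inv]
  refine mul_le_mul_of_nonneg_right ?_ (by positivity)
  -- A sphere is a difference of consecutive balls, bounded using f above and lam f below.
  have h2 : ((S.filter fun x => F.length x = n + 1).card : ℝ) + F.growth n ≤ F.growth (n + 1) := by
    exact_mod_cast F.card_filter_length_succ_add_le S n
  have h3 := (hf (n + 1)).2
  push_cast at h3
  linarith [(hf n).1]

end SymmGenSet

/-! ### The constant `boundM` -/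

section Constants

variable {α C β : ℝ}

theorem bddAbove_boundM_set (α C β : ℝ) :
    BddAbove {v | ∃ t s r : ℕ, (t : ℝ) ≤ 4 * thresholdK α C β ∧ (s : ℝ) ≤ 4 * thresholdK α C β ∧
      (r : ℝ) ≤ 4 * thresholdK α C β ∧
      v = Real.exp (expPolyGap α C β t - expPolyGap α C β s - expPolyGap α C β r)} := by
  have hfin : {n : ℕ | (n : ℝ) ≤ 4 * thresholdK α C β}.Finite :=
    (Set.finite_Iic ⌊4 * thresholdK α C β⌋₊).subset fun n hn => Nat.le_floor hn
  refine (((hfin.prod (hfin.prod hfin)).image fun p : ℕ × ℕ × ℕ =>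
    Real.exp (expPolyGap α C β p.1 - expPolyGap α C β p.2.1 - expPolyGap α C β p.2.2)).subset
      ?_).bddAbove
  rintro v ⟨t, s, r, ht, hs, hr, rfl⟩
  exact ⟨(t, s, r), ⟨ht, hs, hr⟩, rfl⟩

theorem expPolyGap_zero (hα0 : 0 < α) : expPolyGap α C β 0 = 0 := by
  simp [expPolyGap, Real.zero_rpow hα0.ne']

/-- The triple (t, 0, 0) is admissible and p(0) = 0. -/
theorem exp_expPolyGap_le_boundM (hα0 : 0 < α) {t : ℕ} (ht : (t : ℝ) ≤ 4 * thresholdK α C β) :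
    Real.exp (expPolyGap α C β t) ≤ boundM α C β := by
  have h0 : ((0 : ℕ) : ℝ) ≤ 4 * thresholdK α C β := le_trans (by simp) ht
  refine le_csSup (bddAbove_boundM_set α C β) ⟨t, 0, 0, ht, h0, h0, ?_⟩
  simp [expPolyGap_zero hα0]

theorem thresholdK_pos (hα0 : 0 < α) (hα1 : α < 1) (hC : 0 < C) (hβ : 1 ≤ β) :
    0 < thresholdK α C β := by
  have : 0 < 1 - α := by linarith
  exact Real.rpow_pos_of_pos (by positivity) _

theorem one_le_boundM (hα0 : 0 < α) (hα1 : α < 1) (hC : 0 < C) (hβ : 1 ≤ β) :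
    1 ≤ boundM α C β := by
  have h := exp_expPolyGap_le_boundM (C := C) (β := β) hα0 (t := 0)
    (by have := thresholdK_pos hα0 hα1 hC hβ; simpa using this.le)
  simpa [expPolyGap_zero hα0] using h

theorem thresholdK_rpow (hα0 : 0 < α) (hα1 : α < 1) (hC : 0 < C) :
    thresholdK α C β ^ α = β ^ 2 / (C * α * (1 - α)) := by
  have : 0 < 1 - α := by linarith
  rw [thresholdK, one_div, Real.rpow_inv_rpow (by positivity) hα0.ne']

/-- The exponent of `expDecay` in terms of the threshold. -/
theorem expDecay_exponent_eq (hα0 : 0 < α) (hα1 : α < 1) (hC : 0 < C) (hβ : 1 ≤ β) {s : ℝ}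
    (hs : 0 < s) : C * (1 - α) * s ^ α =
      β ^ 2 / α * Real.exp (α * (Real.log s - Real.log (thresholdK α C β))) := by
  have hK := thresholdK_pos hα0 hα1 hC hβ
  have h1 : 0 < 1 - α := by linarith
  rw [← Real.log_div hs.ne' hK.ne', mul_comm α, ← Real.rpow_def_of_pos (div_pos hs hK),
    Real.div_rpow hs.le hK.le, thresholdK_rpow hα0 hα1 hC]
  field_simp

theorem log_one_add_le_log_two_add {s : ℝ} (hs : 1 ≤ s) :
    Real.log (1 + s) ≤ Real.log 2 + Real.log s := by
  rw [← Real.log_mul two_ne_zero (by positivity)]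
  exact Real.log_le_log (by positivity) (by linarith)

theorem two_mul_le_exp (y : ℝ) : 2 * y ≤ Real.exp y := by
  have h1 := Real.add_one_le_exp (y - 1)
  have h2 := Real.add_one_le_exp (1 : ℝ)
  have h3 : Real.exp y = Real.exp (y - 1) * Real.exp 1 := by rw [← Real.exp_add]; ring_nf
  have h4 := Real.exp_pos (y - 1)
  nlinarith

/-- Here only M ≥ 1 is used. From e^y ≥ 2y the decay exponent is at least 2β²(log s - log K), and 4K
< 1 makes this at least 2β(log s + 2 log 2), enough for β log(1+s) + 3 log 2. -/
theorem log_expDecay_bound_of_lt (hα0 : 0 < α) (hα1 : α < 1) (hC : 0 < C) (hβ : 1 ≤ β)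
    (hK : 4 * thresholdK α C β < 1) {s : ℝ} (hs : 1 ≤ s) :
    β * Real.log (1 + s) - C * (1 - α) * s ^ α + 3 * Real.log 2 ≤ 0 := by
  have hK0 := thresholdK_pos hα0 hα1 hC hβ
  rw [expDecay_exponent_eq hα0 hα1 hC hβ (by linarith)]
  set k := Real.log (thresholdK α C β) with hk
  have hk1 : 2 * Real.log 2 + k < 0 := by
    have := Real.log_neg (by positivity) hK
    rw [Real.log_mul (by norm_num) hK0.ne', show (4 : ℝ) = 2 ^ 2 by norm_num, Real.log_pow] at this
    push_cast at this
    exact this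
  have hl2 := Real.log_pos one_lt_two
  have hls := Real.log_nonneg hs
  have h1 := two_mul_le_exp (α * (Real.log s - k))
  have h2 : β ^ 2 / α * (2 * (α * (Real.log s - k)))
      ≤ β ^ 2 / α * Real.exp (α * (Real.log s - k)) :=
    mul_le_mul_of_nonneg_left h1 (by positivity)
  have h3 : β ^ 2 / α * (2 * (α * (Real.log s - k))) = 2 * β ^ 2 * (Real.log s - k) := by
    field_simp
  have h4 : 2 * β * (Real.log s + 2 * Real.log 2) ≤ 2 * β ^ 2 * (Real.log s - k) := by
    have : β ≤ β ^ 2 := by nlinarith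
    refine mul_le_mul (by linarith) (by linarith) (by positivity) (by positivity)
  have h5 := mul_le_mul_of_nonneg_left (log_one_add_le_log_two_add hs) (by linarith : 0 ≤ β)
  nlinarith

/-- The left side is affine in α. Its values at α = 0 and α = 1 are bounded by β and β(2 + log 2),
using tangents of log at 5 and at 2. The interpolant is at most (1 + α log 2)(1 + α)β, and 2^α ≥ 1 +
α log 2, 1/(1-α) ≥ 1 + α. -/
theorem numerical_bound (hα0 : 0 < α) (hα1 : α < 1) (hβ : 1 ≤ β) :
    7 * α * Real.log 2 + 5 * Real.log β - 2 * Real.log 6 - 1 ≤ 2 ^ α * β / (1 - α) := by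
  have hl2 := Real.log_two_gt_d9
  have hl2' := Real.log_two_lt_d9
  have hl6 : 2 * Real.log 2 ≤ Real.log 6 := by
    have : 2 * Real.log 2 = Real.log 4 := by
      rw [show (4 : ℝ) = 2 ^ 2 by norm_num, Real.log_pow]; norm_num
    rw [this]
    exact Real.log_le_log (by norm_num) (by norm_num)
  have hl5 : Real.log 5 ≤ 2 * Real.log 2 + 1 / 4 := by
    have h1 : Real.log 5 = 2 * Real.log 2 + Real.log (5 / 4) := by
      rw [show (5 : ℝ) = 2 ^ 2 * (5 / 4) by norm_num, Real.log_mul (by norm_num) (by norm_num),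
        Real.log_pow]
      norm_num
    have h2 := Real.log_le_sub_one_of_pos (show (0 : ℝ) < 5 / 4 by norm_num)
    linarith
  have hb : ∀ c : ℝ, 0 < c → Real.log β ≤ β / c - 1 + Real.log c := fun c hc => by
    have := Real.log_le_sub_one_of_pos (div_pos (by linarith : 0 < β) hc)
    rw [Real.log_div (by linarith) hc.ne'] at this
    linarith
  have hb5 := hb 5 (by norm_num)
  have hb2 := hb 2 (by norm_num)
  have h0 : 5 * Real.log β - 2 * Real.log 6 - 1 ≤ β := by linarith
  have h1 : 7 * Real.log 2 + 5 * Real.log β - 2 * Real.log 6 - 1 ≤ β * (2 + Real.log 2) := by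
    nlinarith
  have h2 : 1 + α * Real.log 2 ≤ 2 ^ α := by
    rw [Real.rpow_def_of_pos two_pos, mul_comm (Real.log 2)]
    linarith [Real.add_one_le_exp (α * Real.log 2)]
  have h3 : (1 + α * Real.log 2) * (1 + α) * β ≤ 2 ^ α * β / (1 - α) := by
    rw [le_div_iff₀ (by linarith)]
    have h4 : (1 + α) * (1 - α) ≤ 1 := by nlinarith
    calc (1 + α * Real.log 2) * (1 + α) * β * (1 - α)
        = (1 + α * Real.log 2) * β * ((1 + α) * (1 - α)) := by ring
      _ ≤ (1 + α * Real.log 2) * β * 1 := mul_le_mul_of_nonneg_left h4 (by positivity)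
      _ ≤ 2 ^ α * β := by
        rw [mul_one]; exact mul_le_mul_of_nonneg_right h2 (by linarith)
  have h5 := mul_le_mul_of_nonneg_left h0 (by linarith : 0 ≤ 1 - α)
  have h6 := mul_le_mul_of_nonneg_left h1 hα0.le
  have h7 : 0 ≤ α * Real.log 2 * α * β := by positivity
  nlinarith

/-- At t = ⌊4K⌋ the gap p(t) is large since 2K ≤ t and 1 + t ≤ 8K. A tangent-line bound for the
exponential removes s, and the bound on log K leaves `numerical_bound` multiplied by β/α. -/
theorem log_expDecay_bound_of_le (hα0 : 0 < α) (hα1 : α < 1) (hC : 0 < C) (hβ : 1 ≤ β)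
    (hβ6 : 6 / (C * α * (1 - α)) ≤ β) (hK : 1 ≤ 4 * thresholdK α C β) {s : ℝ} (hs : 1 ≤ s) :
    β * Real.log (1 + s) - C * (1 - α) * s ^ α + 3 * Real.log 2 ≤
      expPolyGap α C β ⌊4 * thresholdK α C β⌋₊ := by
  have hK0 := thresholdK_pos hα0 hα1 hC hβ
  have hα1' : 0 < 1 - α := by linarith
  have hQ : 0 < C * α * (1 - α) := by positivity
  have hβ0 : 0 < β := by linarith
  have hl2 := Real.log_pos one_lt_two
  rw [expDecay_exponent_eq hα0 hα1 hC hβ (by linarith)]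
  set K := thresholdK α C β with hKdef
  set k := Real.log K with hk
  set t : ℕ := ⌊4 * K⌋₊ with ht
  have ht1 : (1 : ℝ) ≤ t := by exact_mod_cast Nat.le_floor (by simpa using hK)
  have ht4 : (t : ℝ) ≤ 4 * K := Nat.floor_le (by positivity)
  have ht2 : 2 * K ≤ t := by linarith [Nat.lt_floor_add_one (4 * K)]
  have hgap : 2 ^ α * β ^ 2 / (α * (1 - α)) - β * (3 * Real.log 2 + k) ≤ expPolyGap α C β t := by
    rw [expPolyGap]
    have h1 : C * (2 * K) ^ α ≤ C * (t : ℝ) ^ α :=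
      mul_le_mul_of_nonneg_left (Real.rpow_le_rpow (by positivity) ht2 hα0.le) hC.le
    rw [Real.mul_rpow two_pos.le hK0.le, thresholdK_rpow hα0 hα1 hC] at h1
    have h2 : C * (2 ^ α * (β ^ 2 / (C * α * (1 - α)))) = 2 ^ α * β ^ 2 / (α * (1 - α)) := by
      field_simp
    have h3 : Real.log (1 + t) ≤ 3 * Real.log 2 + k := by
      have : 3 * Real.log 2 + k = Real.log (2 ^ 3 * K) := by
        rw [Real.log_mul (by norm_num) hK0.ne', Real.log_pow]; norm_num [hk]
      rw [this]
      exact Real.log_le_log (by positivity) (by linarith)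
    have h4 := mul_le_mul_of_nonneg_left h3 hβ0.le
    linarith
  have hlogK : α * k ≤ 3 * Real.log β - Real.log 6 := by
    have h1 : α * k = Real.log (K ^ α) := (Real.log_rpow hK0 α).symm
    rw [h1, thresholdK_rpow hα0 hα1 hC]
    have h2 : β ^ 2 / (C * α * (1 - α)) ≤ β ^ 3 / 6 := by
      have h3 : 6 ≤ β * (C * α * (1 - α)) := (div_le_iff₀ hQ).1 hβ6
      rw [div_le_div_iff₀ hQ (by norm_num)]
      calc β ^ 2 * 6 ≤ β ^ 2 * (β * (C * α * (1 - α))) :=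
            mul_le_mul_of_nonneg_left h3 (by positivity)
        _ = _ := by ring
    refine (Real.log_le_log (by positivity) h2).trans (le_of_eq ?_)
    rw [Real.log_div (by positivity) (by norm_num), Real.log_pow]
    norm_num
  -- The shift by log β makes the tangent have slope exactly β in log s, cancelling the main term of
  -- β log(1+s).
  have hexp : β / α * (1 + Real.log β) + β * (Real.log s - k)
      ≤ β ^ 2 / α * Real.exp (α * (Real.log s - k)) := by
    have h1 := Real.add_one_le_exp (α * (Real.log s - k) + Real.log β)
    rw [Real.exp_add, Real.exp_log hβ0] at h1
    have h2 := mul_le_mul_of_nonneg_left h1 (by positivity : 0 ≤ β / α)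
    calc _ = β / α * (α * (Real.log s - k) + Real.log β + 1) := by field_simp; ring
      _ ≤ _ := h2
      _ = _ := by ring
  have h5 := mul_le_mul_of_nonneg_left (log_one_add_le_log_two_add hs) hβ0.le
  have hnum := mul_le_mul_of_nonneg_left (numerical_bound hα0 hα1 hβ)
    (by positivity : 0 ≤ β / α)
  have h6 : β / α * (2 ^ α * β / (1 - α)) = 2 ^ α * β ^ 2 / (α * (1 - α)) := by field_simp
  have h7 := mul_le_mul_of_nonneg_left hlogK (by positivity : 0 ≤ 2 * (β / α))
  have h8 : 2 * (β / α) * (α * k) = 2 * β * k := by field_simp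
  have h9 : β / α * (7 * α * Real.log 2 + 5 * Real.log β - 2 * Real.log 6 - 1)
      = 7 * β * Real.log 2 + β / α * (5 * Real.log β - 2 * Real.log 6 - 1) := by
    field_simp; ring
  rw [h6, h9] at hnum
  rw [h8] at h7
  have h10 : Real.log 2 ≤ β * Real.log 2 := le_mul_of_one_le_left hl2.le hβ
  linarith

/-- The length 0 is excluded because there the decay equals 1, while M/8 may be less than 1. The
factor 8 appears as 3 log 2 in the two logarithmic bounds. -/
theorem expDecay_mul_rpow_le (hα0 : 0 < α) (hα1 : α < 1) (hC : 0 < C) (hβ : 1 ≤ β)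
    (hβ6 : 6 / (C * α * (1 - α)) ≤ β) {s : ℕ} (hs : s ≠ 0) :
    expDecay α C s ≤ boundM α C β / 8 * (1 + (s : ℝ)) ^ (-β) := by
  have hs1 : (1 : ℝ) ≤ s := by exact_mod_cast Nat.one_le_iff_ne_zero.2 hs
  have hspos : (0 : ℝ) < 1 + s := by positivity
  have key : Real.exp (β * Real.log (1 + s) - C * (1 - α) * (s : ℝ) ^ α + 3 * Real.log 2)
      ≤ boundM α C β := by
    rcases lt_or_ge (4 * thresholdK α C β) 1 with h | h
    · refine le_trans ?_ (one_le_boundM hα0 hα1 hC hβ)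
      rw [Real.exp_le_one_iff]
      exact log_expDecay_bound_of_lt hα0 hα1 hC hβ h hs1
    · refine le_trans (Real.exp_le_exp.2 (log_expDecay_bound_of_le hα0 hα1 hC hβ hβ6 h hs1))
        (exp_expPolyGap_le_boundM hα0 (Nat.floor_le (by linarith)))
  have h1 : Real.exp (β * Real.log (1 + s) - C * (1 - α) * (s : ℝ) ^ α + 3 * Real.log 2)
      = expDecay α C s * (1 + (s : ℝ)) ^ β * 8 := by
    rw [Real.exp_add, sub_eq_add_neg, Real.exp_add, expDecay, Real.rpow_def_of_pos hspos,
      mul_comm (Real.log (1 + (s : ℝ))),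
      show 3 * Real.log 2 = Real.log (2 ^ 3) by rw [Real.log_pow]; norm_num,
      Real.exp_log (by norm_num)]
    ring
  rw [h1] at key
  have hr := Real.rpow_pos_of_pos hspos β
  rw [Real.rpow_neg hspos.le, ← div_eq_mul_inv, le_div_iff₀ hr]
  linarith

end Constants

/-! ### Injective bounds for the exponential weights and the final theorem. -/

section Main

variable {G : Type u} [Group G] (F : SymmGenSet G) {α C : ℝ}

/-- The square summable weight majorizing the submultiplicativity defect off the identity. -/
def SymmGenSet.offDiag [DecidableEq G] (β : ℝ) (x : G) : ℝ :=
  if x = 1 then 0 else (1 + (F.length x : ℝ)) ^ (-β)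

/-- The defect is cut into the cross through the identity, with weight 1, and two square summable
weights depending on one variable each. -/
theorem max_expDecay_le [DecidableEq G] (hα0 : 0 < α) (hα1 : α < 1) (hC : 0 < C) {β : ℝ}
    (hβ : 1 ≤ β) (hβ6 : 6 / (C * α * (1 - α)) ≤ β) (x y : G) :
    max (expDecay α C (F.length x)) (expDecay α C (F.length y)) ≤
      (if x = 1 ∨ y = 1 then 1 else 0) +
        boundM α C β / 8 * (F.offDiag β x + F.offDiag β y) := by
  have hM := one_le_boundM (β := β) hα0 hα1 hC hβ
  have hnn : ∀ x, 0 ≤ F.offDiag β x := fun x => by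
    unfold SymmGenSet.offDiag; split_ifs <;> positivity
  have h0 : 0 ≤ boundM α C β / 8 := by linarith
  have hx0 := mul_nonneg h0 (hnn x)
  have hy0 := mul_nonneg h0 (hnn y)
  split_ifs with h
  · have := max_le (expDecay_le_one hα1 hC (F.length x)) (expDecay_le_one hα1 hC (F.length y))
    linarith
  · have hle : ∀ x, x ≠ 1 → expDecay α C (F.length x) ≤ boundM α C β / 8 * F.offDiag β x := by
      intro x hx
      rw [SymmGenSet.offDiag, if_neg hx]
      exact expDecay_mul_rpow_le hα0 hα1 hC hβ hβ6 fun h => hx (F.eq_one_of_length_eq_zero h)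
    push Not at h
    exact max_le (by linarith [hle x h.1]) (by linarith [hle y h.2])

theorem isInjectiveAlgebra_expWeight_of_growth (hF : F.HasPolynomialGrowth) (hα0 : 0 < α)
    (hα1 : α < 1) (hC : 0 < C) :
    ∃ κ : ℝ, 0 ≤ κ ∧ IsInjectiveAlgebra (WeightedL1 (F.expWeight hα0 hα1 hC)) κ := by
  have hpos : ∀ x, 0 ≤ expDecay α C (F.length x) := fun x => (expDecay_pos _ _ _).le
  have h := MatrixBound.of_summable hpos (F.summable_expDecay_length hF hα0 hα1 hC)
  refine ⟨_, add_nonneg (tsum_nonneg hpos) (tsum_nonneg hpos),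
    WeightedL1.isInjectiveAlgebra_of_matrixBound (add_nonneg (tsum_nonneg hpos) (tsum_nonneg hpos))
      ((h.add h.swap).mono fun x y => ?_) (F.expWeight_mul_le hα0 hα1 hC)⟩
  exact max_le (le_add_of_nonneg_right (hpos y)) (le_add_of_nonneg_left (hpos x))

/-- The excess 3/5 over the constant appearing in δ is affordable because 1 + e(κ + 3/5) ≤ e(1 + κ),
as e ≥ 5/2. -/
theorem isInjectiveAlgebra_expWeight (hα0 : 0 < α) (hα1 : α < 1) (hC : 0 < C) {β : ℝ}
    (hβ : 1 ≤ β) (hβ6 : 6 / (C * α * (1 - α)) ≤ β) (hK : grothendieckConstant ≠ ⊤) {S : ℝ}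
    (hS : 0 ≤ S) (hsum : ∀ T : Finset G, (∀ x ∈ T, x ≠ 1) →
      ∑ x ∈ T, ((1 + (F.length x : ℝ)) ^ (-β)) ^ 2 ≤ S) :
    IsInjectiveAlgebra (WeightedL1 (F.expWeight hα0 hα1 hC))
      (grothendieckConstant.toReal * (boundM α C β * 2 ^ (β - 1)) * (1 + S) ^ (1 / 2 : ℝ)
        + 3 / 5) := by
  classical
  set k := grothendieckConstant.toReal with hk
  set M := boundM α C β with hMdef
  have hk1 : 1 ≤ k := by
    have := ENNReal.toReal_mono hK one_le_grothendieckConstant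
    simpa using this
  have hM : 1 ≤ M := one_le_boundM hα0 hα1 hC hβ
  have hP : (1 : ℝ) ≤ 2 ^ (β - 1) := Real.one_le_rpow one_le_two (by linarith)
  -- The added 1/10 keeps N positive even for S = 0 and still leaves 7/8 + N/4 ≤ √(1+S).
  set N := Real.sqrt (S + 1 / 10) with hN
  have hN0 : 0 < N := Real.sqrt_pos.2 (by linarith)
  have hN2 : N ^ 2 = S + 1 / 10 := Real.sq_sqrt (by linarith)
  rw [← Real.sqrt_eq_rpow]
  set W := Real.sqrt (1 + S) with hW
  have hWN : 7 / 8 + N / 4 ≤ W := by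
    refine Real.le_sqrt_of_sq_le ?_
    nlinarith [sq_nonneg (N - 7 / 30)]
  have hv : ∀ T : Finset G, ∑ x ∈ T, F.offDiag β x ^ 2 ≤ N ^ 2 := by
    intro T
    have h1 : ∑ x ∈ T, F.offDiag β x ^ 2
        = ∑ x ∈ T.filter (· ≠ 1), ((1 + (F.length x : ℝ)) ^ (-β)) ^ 2 := by
      rw [Finset.sum_filter]
      refine Finset.sum_congr rfl fun x _ => ?_
      by_cases hx : x = 1 <;> simp [SymmGenSet.offDiag, hx]
    rw [h1, hN2]
    exact (hsum _ fun x hx => (Finset.mem_filter.1 hx).2).trans (by linarith)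
  have hoff := MatrixBound.of_sum_sq_le hK hN0 hv
  -- These proportions give (7/10)(5/4) = 7/8 as coefficient of the Grothendieck constant and an
  -- absolute part (3/10)·2 = 3/5.
  have hcross := (MatrixBound.cross_grothendieck hK (1 : G)).convexComb (MatrixBound.cross (1 : G))
    (p := 7 / 10) (q := 3 / 10) (by norm_num) (by norm_num) (by norm_num)
  have htot := hcross.add ((hoff.add hoff.swap).const_mul (by linarith : 0 ≤ M / 8))
  have hκ : 7 / 10 * (k * (5 / 4)) + 3 / 10 * 2 + M / 8 * (k * N + k * N)
      ≤ k * (M * 2 ^ (β - 1)) * W + 3 / 5 := by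
    have hMP : M ≤ M * 2 ^ (β - 1) := le_mul_of_one_le_right (by linarith) hP
    have h1 : k * M * (7 / 8 + N / 4) ≤ k * (M * 2 ^ (β - 1)) * W := by
      refine mul_le_mul (mul_le_mul_of_nonneg_left hMP (by linarith)) hWN (by positivity)
        (by positivity)
    have h2 : k ≤ k * M := le_mul_of_one_le_right (by linarith) hM
    linarith
  exact WeightedL1.isInjectiveAlgebra_of_matrixBound (by positivity)
    ((htot.mono (max_expDecay_le F hα0 hα1 hC hβ hβ6)).mono_right hκ)
    (F.expWeight_mul_le hα0 hα1 hC)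

theorem satisfiesVonNeumann_zero (A : Type u) [NormedCommRing A] [NormedAlgebra ℂ A] :
    SatisfiesVonNeumann A 0 1 := by
  intro n a ha P hP
  have ha0 : a = fun _ => 0 := funext fun i => norm_le_zero_iff.1 (ha i)
  have : MvPolynomial.aeval a P = 0 := by
    rw [ha0, MvPolynomial.aeval_zero', hP, map_zero]
  rw [this, norm_zero, one_mul]
  exact (norm_nonneg _).trans (norm_eval_le_polydiscNorm P 0 (by simp))

end Main

end

theorem corollaryT {G : Type u} [Group G] [Infinite G] (F : SymmGenSet G)
    (hF : F.HasPolynomialGrowth) (α C : ℝ) (hα0 : 0 < α) (hα1 : α < 1) (hC : 0 < C) :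
    IsIsomorphicToQAlgebra
        (Subalgebra.center ℂ (WeightedL1 (F.expWeight hα0 hα1 hC))) ∧
      ∀ (f : ℝ[X]) (lam : ℝ), 0 < lam → lam ≤ 1 → f.natDegree = F.growthOrder →
        (∀ n : ℕ, lam * f.eval (n : ℝ) ≤ F.growth n ∧ (F.growth n : ℝ) ≤ f.eval (n : ℝ)) →
        ∀ β : ℝ,
          max 1 (max (6 / (C * α * (1 - α)))
            (((F.growthOrder : ℝ) + (1 - if lam = 1 then 1 else 0)) / 2)) ≤ β →
          SatisfiesVonNeumann
            (Subalgebra.center ℂ (WeightedL1 (F.expWeight hα0 hα1 hC)))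
            (vonNeumannRadius α C β lam f) 1 := by
  refine ⟨?_, fun f lam _ _ _ hf β hβ => ?_⟩
  · obtain ⟨κ, hκ, h⟩ := isInjectiveAlgebra_expWeight_of_growth F hF hα0 hα1 hC
    exact h.center.isIsomorphicToQAlgebra hκ
  have hβ1 : 1 ≤ β := (le_max_left _ _).trans hβ
  have hβ6 : 6 / (C * α * (1 - α)) ≤ β :=
    ((le_max_left _ _).trans (le_max_right _ _)).trans hβ
  have hM := one_le_boundM (β := β) hα0 hα1 hC hβ1
  have h2β : (0 : ℝ) < 2 ^ (β - 1) := by positivity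
  have hMβ : 0 < boundM α C β * 2 ^ (β - 1) := by positivity
  have hMβ' : ENNReal.ofReal (boundM α C β * 2 ^ (β - 1)) ≠ 0 := by
    simpa using hMβ
  have hK0 : grothendieckConstant ≠ 0 := fun h => by
    simpa [h] using one_le_grothendieckConstant
  by_cases hK : grothendieckConstant = ⊤
  · have h0 : vonNeumannRadius α C β lam f = 0 := by
      have h1 : (1 + growthSeries f lam β) ^ (1 / 2 : ℝ) ≠ 0 := by
        simp [ENNReal.rpow_eq_zero_iff]
      rw [vonNeumannRadius, hK, ENNReal.top_mul hMβ', ENNReal.top_mul h1]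
      simp
    rw [h0]
    exact satisfiesVonNeumann_zero _
  by_cases hS : growthSeries f lam β = ⊤
  · have h0 : vonNeumannRadius α C β lam f = 0 := by
      rw [vonNeumannRadius, hS, add_top, ENNReal.top_rpow_of_pos (by norm_num),
        ENNReal.mul_top (mul_ne_zero hK0 hMβ')]
      simp
    rw [h0]
    exact satisfiesVonNeumann_zero _
  have hinj := (isInjectiveAlgebra_expWeight F hα0 hα1 hC hβ1 hβ6 hK ENNReal.toReal_nonneg
    fun T hT => F.sum_sq_le_growthSeries hf hS T hT).center
  set κ : ℝ := grothendieckConstant.toReal * (boundM α C β * 2 ^ (β - 1)) *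
    (1 + (growthSeries f lam β).toReal) ^ (1 / 2 : ℝ) with hκ
  have hκ0 : 0 ≤ κ := by positivity
  have hδ : vonNeumannRadius α C β lam f = (Real.exp 1)⁻¹ * (1 + κ)⁻¹ := by
    have hfin : grothendieckConstant * ENNReal.ofReal (boundM α C β * 2 ^ (β - 1)) *
        (1 + growthSeries f lam β) ^ (1 / 2 : ℝ) ≠ ⊤ :=
      ENNReal.mul_ne_top (ENNReal.mul_ne_top hK ENNReal.ofReal_ne_top)
        (ENNReal.rpow_ne_top_of_nonneg (by norm_num) (ENNReal.add_ne_top.2 ⟨ENNReal.one_ne_top, hS⟩))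
    rw [vonNeumannRadius, ENNReal.toReal_inv, ENNReal.toReal_add ENNReal.one_ne_top hfin,
      ENNReal.toReal_mul, ENNReal.toReal_mul, ENNReal.toReal_ofReal hMβ.le, ← ENNReal.toReal_rpow,
      ENNReal.toReal_add ENNReal.one_ne_top hS, ENNReal.toReal_one]
  -- This absorbs the 3/5: the condition δ(1 + eκ') ≤ 1 for κ' = κ + 3/5 amounts to 1 ≤ (2/5)e.
  have he : (5 / 2 : ℝ) ≤ Real.exp 1 := by linarith [Real.exp_one_gt_d9]
  refine hinj.satisfiesVonNeumann (by rw [hδ]; positivity) (by positivity) ?_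
  rw [hδ, ← mul_inv, inv_mul_le_iff₀ (by positivity)]
  linarith
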